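/- Let $H$ be a complex Hilbert space, let $n$ and $m\ge 1$ be natural numbers, and let $T=(T_1,\dots,T_n)\in L(H)^n$ be a commuting tuple of bounded operators. Write $T:H^n\to H$, $(h_i)\mapsto\sum_{i}T_ih_i$, also for the induced row operator and $T^*:H\to H^n$, $h\mapsto (T_i^*h)_i$, for its adjoint. Suppose that $T$ is a row contraction, that is, the row operator has norm at most $1$, and that $T$ is regular at $z=0$: there is an $\varepsilon>0$ such that, for every $z\in\mathbb C^n$ with $\|z\|<\varepsilon$, the space $(T-Z)H^n$ is closed in $H$ and $H$ is the algebraic direct sum $H=(T-Z)H^n\oplus W(T)$, where $Z:H^n\to H$, $(h_i)\mapsto\sum_i z_ih_i$, and $W(T)=H\ominus\sum_{i}T_iH$. Let $\sigma_T(X)=\sum_{i}T_iXT_i^*$ for $X\in L(H)$ and, for $X\in L(H)$, let $\oplus X$ be the operator $(h_i)\mapsto(Xh_i)$ on $H^n$. Then $T$ satisfies the operator identity \[ (T^*T)^{-1}=\Big(\oplus\sum_{j=0}^{m-1}(-1)^j\binom{m}{j+1}\sigma_T^j(1_H)\Big)\Big|\,\mathrm{Im}\,T^*, \] where $(T^*T)^{-1}$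 denotes the inverse of the operator $T^*T:\mathrm{Im}\,T^*\to\mathrm{Im}\,T^*$, if and only if there is an orthogonal decomposition $H=H_0\oplus H_1$ into closed subspaces reducing $T$, with respect to which $T=T_0\oplus T_1$, such that (a) $T_0\in L(H_0)^n$ is a spherical coisometry, that is, $T_0=(S_1,\dots,S_n)$ is a commuting tuple with $\sum_{i}S_iS_i^*=1_{H_0}$, and (b) $T_1\in L(H_1)^n$ is, for some complex Hilbert space $\mathcal D$, unitarily equivalent to the tuple $M_z=(M_{z_1},\dots,M_{z_n})$ of multiplications by the coordinate functions on $H_m(\mathbb B,\mathcal D)$, the Hilbert space of $\mathcal D$-valued functions on the open Euclidean unit ball $\mathbb B\subset\mathbb C^n$ with reproducing kernel $K(z,w)=(1-\langle z,w\rangle)^{-m}\,1_{\mathcal D}$. Here $H_0$, $H_1$ and $\mathcal D$ may be zero. -/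

import Mathlib

open scoped ComplexOrder InnerProductSpace

universe u

/-! ### The Hilbert function space `H_m(𝔹, 𝒟)` -/

/-- The open Euclidean unit ball `𝔹 ⊆ ℂⁿ`. -/
abbrev UnitBall (n : ℕ) : Type := Metric.ball (0 : EuclideanSpace ℂ (Fin n)) 1

/-- The scalar kernel `(z, w) ↦ (1 - ⟨z, w⟩)⁻ᵐ` with `⟨z, w⟩ = ∑ᵢ zᵢ w̄ᵢ`
(in Mathlib's convention the inner product is conjugate linear in its first argument). -/
noncomputable def scalarKernel (n m : ℕ) : Matrix (UnitBall n) (UnitBall n) ℂ :=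
  Matrix.of fun z w => ((1 - inner ℂ (w : EuclideanSpace ℂ (Fin n)) z) ^ m)⁻¹

/-- The operator-valued kernel `K_m(z, w) = (1 - ⟨z, w⟩)⁻ᵐ · 1_𝒟`. -/
noncomputable def opKernel (n m : ℕ) (D : Type*) [NormedAddCommGroup D] [InnerProductSpace ℂ D] :
    Matrix (UnitBall n) (UnitBall n) (D →L[ℂ] D) :=
  Matrix.of fun z w => scalarKernel n m z w • ContinuousLinearMap.id ℂ D

theorem posSemidef_gramMatrix {X E : Type*} [NormedAddCommGroup E] [InnerProductSpace ℂ E]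
    (v : X → E) : (Matrix.gram ℂ v).PosSemidef := by
  refine ⟨Matrix.isHermitian_gram ℂ v, fun x => ?_⟩
  have h : (x.sum fun i xi => x.sum fun j xj => star xi * Matrix.gram ℂ v i j * xj) =
      inner ℂ (x.sum fun i xi => xi • v i) (x.sum fun i xi => xi • v i) := by
    simp only [Finsupp.sum, sum_inner]
    refine Finset.sum_congr rfl fun i _ => ?_
    rw [inner_sum]
    refine Finset.sum_congr rfl fun j _ => ?_
    simp only [inner_smul_left, inner_smul_right, Matrix.gram_apply, RCLike.star_def]
    ring
  rw [h, inner_self_eq_norm_sq_to_K]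
  have h0 := Complex.zero_le_real.2 (sq_nonneg ‖x.sum fun i xi => xi • v i‖)
  rw [Complex.ofReal_pow] at h0
  exact h0

theorem posSemidef_entrywise_pow {X : Type*} {A : Matrix X X ℂ} (hA : A.PosSemidef) (k : ℕ) :
    (Matrix.of fun x y => A x y ^ k : Matrix X X ℂ).PosSemidef := by
  induction k with
  | zero =>
    have h := posSemidef_gramMatrix (fun _ : X => (1 : ℂ))
    have e : (Matrix.of fun x y => A x y ^ 0 : Matrix X X ℂ) = Matrix.gram ℂ fun _ => (1 : ℂ) := by
      ext i j
      simp
    rw [e]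
    exact h
  | succ k ih =>
    have e : (Matrix.of fun x y => A x y ^ (k + 1) : Matrix X X ℂ) =
        Matrix.hadamard (Matrix.of fun x y => A x y ^ k) A := by
      ext i j
      simp [pow_succ]
    rw [e]
    exact Matrix.PosSemidef.hadamard ih hA

theorem posSemidef_scalarKernel_one (n : ℕ) : (scalarKernel n 1).PosSemidef := by
  set G : Matrix (UnitBall n) (UnitBall n) ℂ :=
    Matrix.of fun z w => inner ℂ (w : EuclideanSpace ℂ (Fin n)) z with hG
  have hGp : G.PosSemidef :=
    (posSemidef_gramMatrix fun z : UnitBall n => (z : EuclideanSpace ℂ (Fin n))).transpose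
  have hlt : ∀ z w : UnitBall n, ‖G z w‖ < 1 := by
    intro z w
    have hz : ‖(z : EuclideanSpace ℂ (Fin n))‖ < 1 := mem_ball_zero_iff.1 z.2
    have hw : ‖(w : EuclideanSpace ℂ (Fin n))‖ < 1 := mem_ball_zero_iff.1 w.2
    calc ‖G z w‖ ≤ ‖(w : EuclideanSpace ℂ (Fin n))‖ * ‖(z : EuclideanSpace ℂ (Fin n))‖ :=
          norm_inner_le_norm (𝕜 := ℂ) (w : EuclideanSpace ℂ (Fin n)) _
      _ < 1 := by nlinarith [norm_nonneg (z : EuclideanSpace ℂ (Fin n)),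
          norm_nonneg (w : EuclideanSpace ℂ (Fin n))]
  have hlim : ∀ z w : UnitBall n, HasSum (fun k : ℕ => G z w ^ k) (scalarKernel n 1 z w) := by
    intro z w
    have h := hasSum_geometric_of_norm_lt_one (hlt z w)
    simpa [scalarKernel, hG] using h
  refine ⟨?_, fun x => ?_⟩
  · ext z w
    simp [scalarKernel]
  · have hs : HasSum (fun k : ℕ => x.sum fun i xi => x.sum fun j xj => star xi * G i j ^ k * xj)
        (x.sum fun i xi => x.sum fun j xj => star xi * scalarKernel n 1 i j * xj) := by
      refine hasSum_sum fun i _ => hasSum_sum fun j _ => ?_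
      exact ((hlim i j).mul_left _).mul_right _
    exact hs.nonneg fun k => (posSemidef_entrywise_pow hGp k).2 x

theorem posSemidef_scalarKernel (n m : ℕ) : (scalarKernel n m).PosSemidef := by
  have e : scalarKernel n m = Matrix.of fun z w => scalarKernel n 1 z w ^ m := by
    ext i j
    simp [scalarKernel]
  rw [e]
  exact posSemidef_entrywise_pow (posSemidef_scalarKernel_one n) m

theorem posSemidef_opKernel (n m : ℕ) (D : Type*) [NormedAddCommGroup D] [InnerProductSpace ℂ D]
    [CompleteSpace D] : (opKernel n m D).PosSemidef := by
  have key := (RKHS.posSemidef_tfae (K := opKernel n m D)).out 0 2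
  refine key.2 ⟨?_, fun v => ?_⟩
  · ext1 z w
    have h := (posSemidef_scalarKernel n m).isHermitian.apply z w
    simp only [Matrix.conjTranspose_apply, opKernel, Matrix.of_apply, star_smul, h]
    congr 1
    exact star_one _
  · classical
    have hsub : (Finsupp.indicator v.support fun _ _ => (1 : ℂ)).support ⊆ v.support :=
      Finsupp.support_indicator_subset _ _
    have h := ((posSemidef_scalarKernel n m).hadamard
      (posSemidef_gramMatrix fun z => v z)).2 (Finsupp.indicator v.support fun _ _ => 1)
    rw [Finsupp.sum_of_support_subset _ hsub _ (by simp)] at h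
    refine (Complex.le_def.1 h).1.trans_eq ?_
    refine congrArg Complex.re (Finset.sum_congr rfl fun x hx => ?_)
    rw [Finsupp.sum_of_support_subset _ hsub _ (by simp)]
    refine Finset.sum_congr rfl fun y hy => ?_
    have hk := (posSemidef_scalarKernel n m).isHermitian.apply x y
    simp only [Finsupp.indicator_of_mem hx, Finsupp.indicator_of_mem hy]
    simp only [opKernel, Matrix.of_apply, smul_apply,
      ContinuousLinearMap.id_apply, inner_smul_left, Matrix.hadamard_apply, Matrix.gram_apply,
      star_one, one_mul, mul_one]
    rw [← hk]
    rfl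

instance fact_posSemidef_opKernel (n m : ℕ) (D : Type*) [NormedAddCommGroup D]
    [InnerProductSpace ℂ D] [CompleteSpace D] : Fact (opKernel n m D).PosSemidef :=
  ⟨posSemidef_opKernel n m D⟩

/-- `H_m(𝔹, 𝒟)`: the Hilbert space of `𝒟`-valued functions on the unit ball of `ℂⁿ` with
reproducing kernel `K_m(z, w) = (1 - ⟨z, w⟩)⁻ᵐ · 1_𝒟`. -/
abbrev BallSpace (n m : ℕ) (D : Type*) [NormedAddCommGroup D] [InnerProductSpace ℂ D]
    [CompleteSpace D] := RKHS.OfKernel (opKernel n m D)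

/-! ### Tuples of operators -/

section Tuples

variable {n : ℕ} {E : Type*} [NormedAddCommGroup E] [InnerProductSpace ℂ E]

/-- The operators of the tuple commute pairwise. -/
def IsCommutingTuple (T : Fin n → E →L[ℂ] E) : Prop :=
  ∀ i j, Commute (T i) (T j)

/-- The row operator `Eⁿ → E`, `(hᵢ) ↦ ∑ᵢ Tᵢ hᵢ`, on the Hilbert space direct sum `Eⁿ`. -/
noncomputable def rowOp (T : Fin n → E →L[ℂ] E) : PiLp 2 (fun _ : Fin n => E) →L[ℂ] E :=
  ∑ i, T i ∘L PiLp.proj 2 (fun _ : Fin n => E) i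

/-- The row operator `Z : Eⁿ → E`, `(hᵢ) ↦ ∑ᵢ zᵢ hᵢ`. -/
noncomputable def scalarRow (E : Type*) [NormedAddCommGroup E] [InnerProductSpace ℂ E]
    (z : EuclideanSpace ℂ (Fin n)) : PiLp 2 (fun _ : Fin n => E) →L[ℂ] E :=
  rowOp fun i => z i • ContinuousLinearMap.id ℂ E

/-- `T` is a row contraction: its row operator has norm at most one. -/
def IsRowContraction (T : Fin n → E →L[ℂ] E) : Prop :=
  ‖rowOp T‖ ≤ 1

/-- The wandering subspace `W(T) = E ⊖ ∑ᵢ Tᵢ E`. -/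
noncomputable def wanderingSubspace (T : Fin n → E →L[ℂ] E) : Submodule ℂ E :=
  (rowOp T).rangeᗮ

/-- `T` is regular at `z = 0`: for all `z` near `0` the range `(T - Z)Eⁿ` is closed and `E` is
the algebraic direct sum of `(T - Z)Eⁿ` and `W(T)`. -/
def IsRegularAtZero (T : Fin n → E →L[ℂ] E) : Prop :=
  ∃ ε : ℝ, 0 < ε ∧ ∀ z : EuclideanSpace ℂ (Fin n), ‖z‖ < ε →
    IsClosed ((rowOp T - scalarRow E z).range : Set E) ∧
    IsCompl (rowOp T - scalarRow E z).range (wanderingSubspace T)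

/-- The ampliation `⊕X : Eⁿ → Eⁿ`, `(hᵢ) ↦ (X hᵢ)`. -/
noncomputable def ampliation (n : ℕ) (X : E →L[ℂ] E) :
    PiLp 2 (fun _ : Fin n => E) →L[ℂ] PiLp 2 (fun _ : Fin n => E) :=
  (PiLp.continuousLinearEquiv 2 ℂ (fun _ : Fin n => E)).symm.toContinuousLinearMap ∘L
    ContinuousLinearMap.pi fun i => X ∘L PiLp.proj 2 (fun _ : Fin n => E) i

variable [CompleteSpace E]

/-- The map `σ_T(X) = ∑ᵢ Tᵢ X Tᵢ*`. -/
noncomputable def sigmaMap (T : Fin n → E →L[ℂ] E) (X : E →L[ℂ] E) : E →L[ℂ] E :=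
  ∑ i, T i ∘L X ∘L (T i).adjoint

/-- The operator `Δ_T = ∑_{j=0}^{m-1} (-1)ʲ C(m, j+1) σ_Tʲ(1)`. -/
noncomputable def deltaOp (m : ℕ) (T : Fin n → E →L[ℂ] E) : E →L[ℂ] E :=
  ∑ j ∈ Finset.range m,
    ((-1 : ℂ) ^ j * (m.choose (j + 1) : ℂ)) • (sigmaMap T)^[j] (ContinuousLinearMap.id ℂ E)

/-- The identity `(T*T)⁻¹ = (⊕Δ_T)|Im T*`: the operator `⊕Δ_T` maps `Im T*` into itself, and its
restriction to `Im T*` is the two-sided inverse of `T*T : Im T* → Im T*`. -/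
def InverseIdentity (m : ℕ) (T : Fin n → E →L[ℂ] E) : Prop :=
  ∀ y ∈ (rowOp T).adjoint.range,
    ampliation n (deltaOp m T) y ∈ (rowOp T).adjoint.range ∧
    (rowOp T).adjoint (rowOp T (ampliation n (deltaOp m T) y)) = y ∧
    ampliation n (deltaOp m T) ((rowOp T).adjoint (rowOp T y)) = y

/-- A spherical isometry: a commuting tuple with `∑ᵢ Sᵢ* Sᵢ = 1`. -/
def IsSphericalIsometry (S : Fin n → E →L[ℂ] E) : Prop :=
  IsCommutingTuple S ∧ ∑ i, (S i).adjoint ∘L S i = ContinuousLinearMap.id ℂ E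

/-- A spherical coisometry: a commuting tuple whose adjoint tuple is a spherical isometry. -/
def IsSphericalCoisometry (S : Fin n → E →L[ℂ] E) : Prop :=
  IsCommutingTuple S ∧ IsSphericalIsometry fun i => (S i).adjoint

/-- `S` is unitarily equivalent to the `m`-shift, the tuple `M_z = (M_{z₁}, …, M_{zₙ})` of
multiplications by the coordinate functions on `H_m(𝔹, 𝒟)`: there is a unitary
`U : E → H_m(𝔹, 𝒟)` with `U Sᵢ x = zᵢ · U x`, as functions on `𝔹`, for all `i` and `x`. -/
def IsUnitarilyEquivalentToShift (m : ℕ) (D : Type*) [NormedAddCommGroup D]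
    [InnerProductSpace ℂ D] [CompleteSpace D] (S : Fin n → E →L[ℂ] E) : Prop :=
  ∃ U : E ≃ₗᵢ[ℂ] BallSpace n m D,
    ∀ (i : Fin n) (x : E) (z : UnitBall n), U (S i x) z = (z : EuclideanSpace ℂ (Fin n)) i • U x z

end Tuples

/-! ### Scalar identities and power series -/

/-! Write `m = M + 1`, `A(z) = ∑ zᵢTᵢ*`, `cₖ = C(k + M, M)`, `σ` for `sigmaMap T`, `Δ` for `deltaOp
m T`, and let `P` be the projection onto `W(T)`. For the `m`-shift, `f(z) = P (1 - A(z))⁻ᵐ f`; for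
general `T` these operators (`evalOp`) are the candidates for point evaluations. They should turn
`Tᵢ` into multiplication by `zᵢ`, which in Taylor coefficients reads `P Tᵢ = 0` and `cₖ₊₁ P Aᵏ⁺¹ Tᵢ
= cₖ zᵢ P Aᵏ` (`ShiftRelations`). Both implications pass through these relations. Their main
consequence is `c_N P A^N Δ = c_{N+1} P A^N` (`ShiftRelations.pow_deltaOp`).

From the identity to the decomposition: `(⊕Δ)T*` is a left inverse of `T` modulo its kernel, and `P
= 1 - σ(Δ)`. Regularity gives `P (ΔA)ᵏ⁺¹ Tᵢ = zᵢ P (ΔA)ᵏ`, and an induction using the effect of `Δ`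
replaces `P (ΔA)ᵏ` by `cₖ P Aᵏ` (`InverseIdentity.shiftRelations`). The common kernel of the
evaluations is reducing. On it `(1 - σ)ᵐ(1) = 1 - σ(Δ)` vanishes, and contractivity of `σ` improves
this to `σ(1) = 1`: this is the coisometric part. On the orthogonal complement the evaluations
separate points and have kernel `(1 - ⟨z, w⟩)⁻ᵐ`, so uniqueness of reproducing kernel spaces
identifies it with the shift (`exists_linearIsometryEquiv_ofKernel`).

From the decomposition to the identity: evaluation at `0` on the shift part plays the role of `P`,
and its `evalOp` are the point evaluations (`evalOp_compressedEval`). The relations yield `σ(1) Tᵢ Δ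
= Tᵢ` on the shift part, while on the coisometric part `σ(1) = Δ = 1`. Taking adjoints gives `(⊕Δ)
T*T T* = T*`; closedness of the range makes this left inverse two-sided. -/

theorem sum_alternating_choose_mul_choose (M k : ℕ) :
    ∑ j ∈ Finset.range (M + 1), (-1 : ℂ) ^ j * ((M + 1).choose (j + 1) : ℂ) *
      (if j ≤ k then ((k - j + M).choose M : ℂ) else 0) = ((k + 1 + M).choose M : ℂ) := by
  -- Take the coefficient of `X^(k+1)` in `(1 - X)^(M+1) ∑ C(M+n, M) Xⁿ = 1`. Isolating the term `i
  -- = 0` and putting `i = j + 1` accounts for the shifted binomial and the sign.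
  have h := congrArg (PowerSeries.coeff (k + 1))
    (PowerSeries.mk_add_choose_mul_one_sub_pow_eq_one (S := ℂ) M)
  have hpow : ((1 - PowerSeries.X : PowerSeries ℂ)) ^ (M + 1) =
      ∑ i ∈ Finset.range (M + 2), PowerSeries.C ((-1 : ℂ) ^ i * ((M + 1).choose i : ℂ)) *
        PowerSeries.X ^ i := by
    rw [sub_eq_add_neg, add_comm, add_pow]
    refine Finset.sum_congr rfl fun i _ => ?_
    rw [neg_pow]
    simp
    ring
  rw [hpow, Finset.mul_sum, map_sum] at h
  have hterm : ∀ i, PowerSeries.coeff (k + 1)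
      ((PowerSeries.mk fun n => ((M + n).choose M : ℂ)) *
        (PowerSeries.C ((-1 : ℂ) ^ i * ((M + 1).choose i : ℂ)) * PowerSeries.X ^ i)) =
      (-1 : ℂ) ^ i * ((M + 1).choose i : ℂ) *
        (if i ≤ k + 1 then ((k + 1 - i + M).choose M : ℂ) else 0) := by
    intro i
    rw [mul_left_comm, PowerSeries.coeff_C_mul, PowerSeries.coeff_mul_X_pow']
    congr 1
    split_ifs
    · rw [PowerSeries.coeff_mk, add_comm]
    · rfl
  rw [Finset.sum_congr rfl fun i _ => hterm i, Finset.sum_range_succ'] at h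
  simp only [pow_zero, Nat.choose_zero_right, Nat.cast_one, mul_one, one_mul, zero_le, if_true,
    Nat.sub_zero, PowerSeries.coeff_one, Nat.succ_ne_zero, if_false, Nat.add_sub_add_right,
    Nat.add_le_add_iff_right, pow_succ, mul_neg, neg_mul, Finset.sum_neg_distrib] at h
  linear_combination -h

/-- Identities depending on `z` are compared along complex lines in `ℂⁿ`, so uniqueness of Taylor
coefficients in one variable suffices. -/
theorem HasSum.coeff_eq_zero_of_eventually {F : Type*} [NormedAddCommGroup F] [NormedSpace ℂ F]
    {a : ℕ → F} (h : ∀ᶠ t : ℂ in nhds 0, HasSum (fun k => t ^ k • a k) 0) (k : ℕ) : a k = 0 := by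
  set p : FormalMultilinearSeries ℂ ℂ F :=
    fun j => ContinuousMultilinearMap.mkPiRing ℂ (Fin j) (a j) with hp
  have hc : ∀ j, p.coeff j = a j := fun j => by simp [FormalMultilinearSeries.coeff, hp]
  have h0 : HasFPowerSeriesAt (0 : ℂ → F) p 0 := by
    rw [hasFPowerSeriesAt_iff]
    filter_upwards [h] with t ht
    simp only [hc]
    exact ht
  rw [← hc k, h0.eq_zero]
  simp [FormalMultilinearSeries.coeff]

/-- Comparison of coefficients in `∑ aₖ tᵏ = c t ∑ bₖ tᵏ`. -/
theorem HasSum.coeff_eq_of_eventually_eq_smul {F : Type*} [NormedAddCommGroup F]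
    [NormedSpace ℂ F] {a b : ℕ → F} {c : ℂ}
    (h : ∀ᶠ t : ℂ in nhds 0, ∃ s, HasSum (fun k => t ^ k • a k) ((t * c) • s) ∧
      HasSum (fun k => t ^ k • b k) s) : a 0 = 0 ∧ ∀ k, a (k + 1) = c • b k := by
  set d : ℕ → F := fun k => Nat.casesOn k 0 fun j => c • b j with hd
  have key : ∀ k, a k - d k = 0 := by
    refine HasSum.coeff_eq_zero_of_eventually ?_
    filter_upwards [h] with t ht
    obtain ⟨s, h1, h2⟩ := ht
    have h3 : HasSum (fun k => t ^ k • d k) ((t * c) • s) := by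
      rw [← hasSum_nat_add_iff' 1]
      convert h2.const_smul (t * c) using 1
      · funext k
        simp only [hd, smul_smul]
        congr 1
        ring
      · simp [hd]
    have h4 := h1.sub h3
    simpa only [smul_sub, sub_self] using h4
  exact ⟨by simpa [hd] using key 0, fun k => sub_eq_zero.1 (key (k + 1))⟩

/-! ### Uniqueness of reproducing kernel Hilbert spaces -/

section Reproducing

variable {X E V : Type*} [NormedAddCommGroup E] [InnerProductSpace ℂ E]
  [NormedAddCommGroup V] [InnerProductSpace ℂ V]

/-- The finite linear combinations `∑ cᵢ k(xᵢ) vᵢ`. -/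
noncomputable def kernelCombination (k : X → V →L[ℂ] E) : (X × V →₀ ℂ) →ₗ[ℂ] E :=
  Finsupp.linearCombination ℂ fun p : X × V => k p.1 p.2

theorem kernelCombination_single (k : X → V →L[ℂ] E) (x : X) (v : V) :
    kernelCombination k (Finsupp.single (x, v) 1) = k x v := by
  simp [kernelCombination]

theorem inner_kernelCombination (k : X → V →L[ℂ] E) (f g : X × V →₀ ℂ) :
    inner ℂ (kernelCombination k f) (kernelCombination k g) =
      f.sum fun p a => g.sum fun q b => star a * b * inner ℂ (k p.1 p.2) (k q.1 q.2) := by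
  simp only [kernelCombination, Finsupp.linearCombination_apply, Finsupp.sum, sum_inner]
  refine Finset.sum_congr rfl fun i _ => ?_
  rw [inner_sum]
  refine Finset.sum_congr rfl fun j _ => ?_
  simp only [inner_smul_left, inner_smul_right, RCLike.star_def]
  ring

theorem norm_kernelCombination_congr {F : Type*} [NormedAddCommGroup F] [InnerProductSpace ℂ F]
    {k : X → V →L[ℂ] E} {l : X → V →L[ℂ] F}
    (h : ∀ x y u v, inner ℂ (k x u) (k y v) = inner ℂ (l x u) (l y v)) (f : X × V →₀ ℂ) :
    ‖kernelCombination k f‖ = ‖kernelCombination l f‖ := by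
  have e : inner ℂ (kernelCombination k f) (kernelCombination k f) =
      inner ℂ (kernelCombination l f) (kernelCombination l f) := by
    simp only [inner_kernelCombination, h]
  rw [@norm_eq_sqrt_re_inner ℂ, @norm_eq_sqrt_re_inner ℂ, e]

/-- A vector orthogonal to all kernel vectors `(e x)* v` is annihilated by every evaluation. -/
theorem denseRange_kernelCombination [CompleteSpace E] [CompleteSpace V] {e : X → E →L[ℂ] V}
    (h : ∀ f, (∀ x, e x f = 0) → f = 0) :
    DenseRange (kernelCombination fun x => (e x).adjoint) := by
  have ht : (kernelCombination fun x => (e x).adjoint).range.topologicalClosure = ⊤ := by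
    rw [Submodule.topologicalClosure_eq_top_iff, Submodule.eq_bot_iff]
    intro f hf
    refine h f fun x => ext_inner_left ℂ fun v => ?_
    rw [inner_zero_right, ← ContinuousLinearMap.adjoint_inner_left]
    refine hf _ ⟨Finsupp.single (x, v) 1, ?_⟩
    simp [kernelCombination]
  rw [DenseRange, dense_iff_closure_eq]
  exact congrArg (fun S : Submodule ℂ E => (S : Set E)) ht

/-- A Hilbert space with a separating family of bounded `V`-valued evaluations is unitarily
equivalent to the reproducing kernel Hilbert space of its kernel. -/
theorem exists_linearIsometryEquiv_ofKernel [CompleteSpace E] [CompleteSpace V]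
    (K : Matrix X X (V →L[ℂ] V)) [Fact K.PosSemidef] (e : X → E →L[ℂ] V)
    (hK : ∀ x y, e x ∘L (e y).adjoint = K x y) (he : ∀ f, (∀ x, e x f = 0) → f = 0) :
    ∃ U : E ≃ₗᵢ[ℂ] RKHS.OfKernel K, ∀ f x, U f x = e x f := by
  set l : X → V →L[ℂ] RKHS.OfKernel K := RKHS.kerFun (RKHS.OfKernel K) with hl
  have hinner : ∀ x y u v, inner ℂ ((e x).adjoint u) ((e y).adjoint v) =
      inner ℂ (l x u) (l y v) := by
    intro x y u v
    rw [RKHS.kerFun_inner, RKHS.kerFun_apply, RKHS.OfKernel.kernel_ofKernel,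
      ContinuousLinearMap.adjoint_inner_left, ← hK]
    rfl
  have hnorm := norm_kernelCombination_congr (k := fun x => (e x).adjoint) (l := l) hinner
  have hd₁ := denseRange_kernelCombination he
  have hd₂ : DenseRange (kernelCombination l) := by
    have := denseRange_kernelCombination (e := fun x => (l x).adjoint) (fun f hf =>
      RKHS.ext fun x => by simpa [hl] using hf x)
    simpa only [ContinuousLinearMap.adjoint_adjoint] using this
  -- Equal coefficient families give combinations of equal norm on both sides, so matching kernel
  -- vectors is well defined and extends by density.
  set U := LinearEquiv.extendOfIsometry (LinearEquiv.refl ℂ (X × V →₀ ℂ))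
    (kernelCombination fun x => (e x).adjoint) (kernelCombination l) hd₁ hd₂
    (fun f => (hnorm f).symm)
  have hUk : ∀ x v, U ((e x).adjoint v) = l x v := by
    intro x v
    have := LinearEquiv.extendOfIsometry_eq (LinearEquiv.refl ℂ (X × V →₀ ℂ)) _ _ hd₁ hd₂
      (fun f => (hnorm f).symm) (Finsupp.single (x, v) 1)
    rwa [LinearEquiv.refl_apply, kernelCombination_single, kernelCombination_single] at this
  refine ⟨U, fun f x => ext_inner_left ℂ fun v => ?_⟩
  rw [← RKHS.kerFun_inner, ← hl, ← hUk, LinearIsometryEquiv.inner_map_map,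
    ContinuousLinearMap.adjoint_inner_left]

end Reproducing

/-! ### The pencil `∑ᵢ zᵢ Tᵢ*` -/

section Pencil

variable {n : ℕ} {E D : Type*} [NormedAddCommGroup E] [InnerProductSpace ℂ E]
  [NormedAddCommGroup D] [InnerProductSpace ℂ D]

theorem rowOp_apply (T : Fin n → E →L[ℂ] E) (y : PiLp 2 fun _ : Fin n => E) :
    rowOp T y = ∑ i, T i (y i) := by
  simp [rowOp]

theorem scalarRow_apply (z : EuclideanSpace ℂ (Fin n)) (y : PiLp 2 fun _ : Fin n => E) :
    scalarRow E z y = ∑ i, z i • y i := by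
  simp [scalarRow, rowOp_apply]

theorem rowOp_single (T : Fin n → E →L[ℂ] E) (i : Fin n) (x : E) :
    rowOp T (PiLp.single 2 i x) = T i x := by
  rw [rowOp_apply, Finset.sum_eq_single i]
  · simp
  · intro j _ hj
    simp [hj]
  · simp

theorem scalarRow_single (z : EuclideanSpace ℂ (Fin n)) (i : Fin n) (x : E) :
    scalarRow E z (PiLp.single 2 i x) = z i • x :=
  rowOp_single _ i x

theorem tuple_sub_mem_range (T : Fin n → E →L[ℂ] E) (z : EuclideanSpace ℂ (Fin n)) (i : Fin n)
    (x : E) : T i x - z i • x ∈ (rowOp T - scalarRow E z).range :=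
  ⟨PiLp.single 2 i x, by
    rw [ContinuousLinearMap.coe_coe, sub_apply, rowOp_single, scalarRow_single]⟩

theorem ampliation_apply (X : E →L[ℂ] E) (y : PiLp 2 fun _ : Fin n => E) (i : Fin n) :
    ampliation n X y i = X (y i) := by
  simp [ampliation]

theorem norm_ampliation_apply_le (X : E →L[ℂ] E) (y : PiLp 2 fun _ : Fin n => E) :
    ‖ampliation n X y‖ ≤ ‖X‖ * ‖y‖ := by
  rw [← sq_le_sq₀ (norm_nonneg _) (by positivity), mul_pow, PiLp.norm_sq_eq_of_L2,
    PiLp.norm_sq_eq_of_L2, Finset.mul_sum]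
  refine Finset.sum_le_sum fun i _ => ?_
  rw [ampliation_apply, ← mul_pow]
  exact pow_le_pow_left₀ (norm_nonneg _) (X.le_opNorm _) 2

theorem apply_starProjection_of_invariant {K : Submodule ℂ E}
    [K.HasOrthogonalProjection] {A : E →L[ℂ] E}
    (h₀ : ∀ x ∈ K, A x ∈ K) (h₁ : ∀ x ∈ Kᗮ, A x ∈ Kᗮ) (x : E) :
    A (K.starProjection x) = K.starProjection (A x) := by
  symm
  refine Submodule.eq_starProjection_of_mem_orthogonal
    (h₀ _ (Submodule.starProjection_apply_mem _ _)) ?_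
  rw [← map_sub]
  exact h₁ _ (Submodule.sub_starProjection_mem_orthogonal x)

variable [CompleteSpace E]

theorem rowOp_adjoint_apply (T : Fin n → E →L[ℂ] E) (h : E) (i : Fin n) :
    (rowOp T).adjoint h i = (T i).adjoint h := by
  refine ext_inner_right ℂ fun v => ?_
  have h1 := ContinuousLinearMap.adjoint_inner_left (rowOp T) (PiLp.single 2 i v) h
  rw [PiLp.inner_apply, rowOp_apply] at h1
  rw [ContinuousLinearMap.adjoint_inner_left]
  classical
  rw [Finset.sum_eq_single i, Finset.sum_eq_single i] at h1
  · simpa using h1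
  · intro j _ hj
    simp [hj]
  · simp
  · intro j _ hj
    simp [hj]
  · simp

theorem sigmaMap_apply (T : Fin n → E →L[ℂ] E) (X : E →L[ℂ] E) (x : E) :
    sigmaMap T X x = ∑ i, T i (X ((T i).adjoint x)) := by
  simp [sigmaMap]

theorem rowOp_ampliation_adjoint (T : Fin n → E →L[ℂ] E) (X : E →L[ℂ] E) (x : E) :
    rowOp T (ampliation n X ((rowOp T).adjoint x)) = sigmaMap T X x := by
  simp only [rowOp_apply, ampliation_apply, rowOp_adjoint_apply, sigmaMap_apply]

/-- The linear pencil `∑ᵢ zᵢ Tᵢ*`. -/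
noncomputable def adjointPencil (T : Fin n → E →L[ℂ] E) (z : EuclideanSpace ℂ (Fin n)) :
    E →L[ℂ] E :=
  ∑ i, z i • (T i).adjoint

theorem adjointPencil_apply (T : Fin n → E →L[ℂ] E) (z : EuclideanSpace ℂ (Fin n)) (x : E) :
    adjointPencil T z x = ∑ i, z i • (T i).adjoint x := by
  simp [adjointPencil]

theorem adjointPencil_smul (T : Fin n → E →L[ℂ] E) (t : ℂ) (z : EuclideanSpace ℂ (Fin n)) :
    adjointPencil T (t • z) = t • adjointPencil T z := by
  simp [adjointPencil, Finset.smul_sum, mul_smul]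

theorem adjoint_adjointPencil_apply (T : Fin n → E →L[ℂ] E) (z : EuclideanSpace ℂ (Fin n))
    (x : E) : (adjointPencil T z).adjoint x = ∑ i, star (z i) • T i x := by
  refine ext_inner_right ℂ fun y => ?_
  rw [ContinuousLinearMap.adjoint_inner_left, adjointPencil_apply, inner_sum, sum_inner]
  refine Finset.sum_congr rfl fun i _ => ?_
  rw [inner_smul_left, inner_smul_right, ContinuousLinearMap.adjoint_inner_right]
  simp

/-- The adjoint of the pencil sends `x` to the row operator applied to `(z̄ᵢ x)ᵢ`, a vector of norm
`‖z‖ ‖x‖`. -/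
theorem IsRowContraction.norm_adjointPencil_le {T : Fin n → E →L[ℂ] E} (hT : IsRowContraction T)
    (z : EuclideanSpace ℂ (Fin n)) : ‖adjointPencil T z‖ ≤ ‖z‖ := by
  rw [← LinearIsometryEquiv.norm_map ContinuousLinearMap.adjoint]
  refine ContinuousLinearMap.opNorm_le_bound _ (norm_nonneg _) fun x => ?_
  set y : PiLp 2 fun _ : Fin n => E := WithLp.toLp 2 fun i => star (z i) • x with hy
  have h1 : (adjointPencil T z).adjoint x = rowOp T y := by
    rw [adjoint_adjointPencil_apply, rowOp_apply]
    simp [hy]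
  have h2 : ‖y‖ = ‖z‖ * ‖x‖ := by
    rw [← sq_eq_sq₀ (norm_nonneg _) (by positivity), mul_pow, PiLp.norm_sq_eq_of_L2,
      EuclideanSpace.norm_sq_eq, Finset.sum_mul]
    refine Finset.sum_congr rfl fun i _ => ?_
    simp [hy, norm_smul, mul_pow]
  rw [h1, ← h2]
  exact (rowOp T).le_of_opNorm_le hT y |>.trans_eq (one_mul _)

theorem deltaOp_apply (m : ℕ) (T : Fin n → E →L[ℂ] E) (x : E) :
    deltaOp m T x = ∑ j ∈ Finset.range m, ((-1 : ℂ) ^ j * (m.choose (j + 1) : ℂ)) •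
      (sigmaMap T)^[j] (ContinuousLinearMap.id ℂ E) x := by
  simp [deltaOp]

/-- `P (∑ zᵢTᵢ*)ᵏ Tⱼ`, suitably normalised, equals `zⱼ P (∑ zᵢTᵢ*)ᵏ⁻¹` up to degree `N`: the
relations satisfied by the Taylor coefficients at `0` for the multiplication tuple on the space
with kernel `(1 - ⟨z, w⟩)⁻⁽ᴹ⁺¹⁾`. -/
def ShiftRelations (M : ℕ) (T : Fin n → E →L[ℂ] E) (P : E →L[ℂ] D)
    (z : EuclideanSpace ℂ (Fin n)) (N : ℕ) : Prop :=
  (∀ i x, P (T i x) = 0) ∧ ∀ k < N, ∀ i x,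
    ((k + 1 + M).choose M : ℂ) • P ((adjointPencil T z ^ (k + 1)) (T i x)) =
      (((k + M).choose M : ℂ) * z i) • P ((adjointPencil T z ^ k) x)

variable {M N : ℕ} {T : Fin n → E →L[ℂ] E} {P : E →L[ℂ] D} {z : EuclideanSpace ℂ (Fin n)}

/-- The left factor `Tᵢ` of each summand of `σ` is converted into `zᵢ`; the right factors `Tᵢ*` then
reassemble into the pencil. -/
theorem ShiftRelations.pow_sigmaMap (h : ShiftRelations M T P z N) {k : ℕ} (hk : k < N)
    (Y : E →L[ℂ] E) (x : E) :
    ((k + 1 + M).choose M : ℂ) • P ((adjointPencil T z ^ (k + 1)) (sigmaMap T Y x)) =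
      ((k + M).choose M : ℂ) • P ((adjointPencil T z ^ k) (Y (adjointPencil T z x))) := by
  rw [sigmaMap_apply]
  simp only [map_sum, Finset.smul_sum, h.2 k hk]
  have hA : P ((adjointPencil T z ^ k) (Y (adjointPencil T z x))) =
      ∑ i, z i • P ((adjointPencil T z ^ k) (Y ((T i).adjoint x))) := by
    conv_lhs => rw [adjointPencil_apply T z x]
    simp only [map_sum, map_smul]
  rw [hA]
  simp only [Finset.smul_sum, mul_smul]

/-- Each `σ` moves one factor of the pencil to the right and lowers the index of the binomial weight
by one. For `j > k` no power is left and `P Tᵢ = 0` gives zero. -/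
theorem ShiftRelations.pow_sigmaMap_iterate (h : ShiftRelations M T P z N) (j : ℕ) :
    ∀ k ≤ N, ∀ x, ((k + M).choose M : ℂ) •
        P ((adjointPencil T z ^ k) ((sigmaMap T)^[j] (ContinuousLinearMap.id ℂ E) x)) =
      (if j ≤ k then ((k - j + M).choose M : ℂ) else 0) • P ((adjointPencil T z ^ k) x) := by
  induction j with
  | zero => simp
  | succ j ih =>
    intro k hk x
    rw [Function.iterate_succ_apply']
    cases k with
    | zero => simp [sigmaMap_apply, h.1]
    | succ k =>
      rw [h.pow_sigmaMap hk, ih k (Nat.le_of_succ_le hk)]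
      simp only [pow_succ, mul_apply_eq_comp, Nat.add_le_add_iff_right, Nat.add_sub_add_right]

/-- The coefficients of `Δ` are those for which the weights of the iterates of `σ` add up to the
next weight. Only relations in degrees below `N` enter, which is what permits the induction in
`InverseIdentity.shiftRelations`. -/
theorem ShiftRelations.pow_deltaOp (h : ShiftRelations M T P z N) (x : E) :
    ((N + M).choose M : ℂ) • P ((adjointPencil T z ^ N) (deltaOp (M + 1) T x)) =
      ((N + 1 + M).choose M : ℂ) • P ((adjointPencil T z ^ N) x) := by
  rw [deltaOp_apply, ← sum_alternating_choose_mul_choose]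
  simp only [map_sum, map_smul, Finset.smul_sum, Finset.sum_smul]
  refine Finset.sum_congr rfl fun j _ => ?_
  rw [smul_comm, h.pow_sigmaMap_iterate j N le_rfl, smul_smul]

/-! ### The evaluations `∑ₖ C(k + M, M) P (∑ᵢ zᵢTᵢ*)ᵏ` -/

/-- The operator `P (1 - ∑ᵢ zᵢTᵢ*)⁻ᵐ`. -/
noncomputable def evalOp (m : ℕ) (T : Fin n → E →L[ℂ] E) (P : E →L[ℂ] D)
    (z : EuclideanSpace ℂ (Fin n)) : E →L[ℂ] D :=
  P ∘L (Ring.inverse (1 - adjointPencil T z)) ^ m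

theorem hasSum_inverse_pow (M : ℕ) {A : E →L[ℂ] E} (hA : ‖A‖ < 1) :
    HasSum (fun k => ((k + M).choose M : ℂ) • A ^ k) (Ring.inverse (1 - A) ^ (M + 1)) := by
  have h := hasSum_choose_mul_geometric_of_norm_lt_one' M hA
  simp only [← nsmul_eq_mul, ← Nat.cast_smul_eq_nsmul ℂ] at h
  exact h

theorem hasSum_evalOp (hT : ‖adjointPencil T z‖ < 1) (x : E) :
    HasSum (fun k => ((k + M).choose M : ℂ) • P ((adjointPencil T z ^ k) x))
      (evalOp (M + 1) T P z x) := by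
  have h := ((hasSum_inverse_pow M hT).mapL (ContinuousLinearMap.apply ℂ E x)).mapL P
  simpa [evalOp] using h

theorem evalOp_apply_tuple (hT : ‖adjointPencil T z‖ < 1) (h : ∀ N, ShiftRelations M T P z N)
    (i : Fin n) (x : E) : evalOp (M + 1) T P z (T i x) = z i • evalOp (M + 1) T P z x := by
  have h1 := hasSum_evalOp (M := M) (P := P) hT (T i x)
  have h2 := (hasSum_evalOp (M := M) (P := P) hT x).const_smul (z i)
  rw [← hasSum_nat_add_iff' 1] at h1
  simp only [Finset.range_one, Finset.sum_singleton, pow_zero, one_apply_eq_self,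
    (h 0).1, smul_zero, sub_zero] at h1
  refine h1.unique (h2.congr_fun ?_)
  intro k
  have := (h (k + 1)).2 k k.lt_succ_self i x
  rw [this, smul_smul, mul_comm]

/-- A joint eigenvector of the adjoint tuple is one of the adjoint of the pencil. -/
theorem apply_adjointPencil_adjoint_pow {e : E →L[ℂ] D} (he : ∀ i x, e (T i x) = z i • e x)
    (w : EuclideanSpace ℂ (Fin n)) (k : ℕ) (x : E) :
    e (((adjointPencil T w).adjoint ^ k) x) = inner ℂ w z ^ k • e x := by
  induction k generalizing x with
  | zero => simp
  | succ k ih =>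
    rw [pow_succ, mul_apply_eq_comp, ih, adjoint_adjointPencil_apply, map_sum, pow_succ,
      mul_smul, PiLp.inner_apply, Finset.sum_smul]
    congr 1
    refine Finset.sum_congr rfl fun i _ => ?_
    rw [map_smul, he, smul_smul]
    simp [mul_comm]

variable [CompleteSpace D]

theorem hasSum_adjoint_evalOp (hT : ‖adjointPencil T z‖ < 1) (d : D) :
    HasSum (fun k => ((k + M).choose M : ℂ) • ((adjointPencil T z).adjoint ^ k) (P.adjoint d))
      ((evalOp (M + 1) T P z).adjoint d) := by
  have h := (hasSum_inverse_pow M hT).star.mapL (ContinuousLinearMap.apply ℂ E (P.adjoint d))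
  have e : (evalOp (M + 1) T P z).adjoint d =
      star (Ring.inverse (1 - adjointPencil T z) ^ (M + 1)) (P.adjoint d) := by
    rw [evalOp, ContinuousLinearMap.adjoint_comp]
    rfl
  rw [e]
  convert h using 2 with k
  · rw [star_smul, star_pow]
    simp [ContinuousLinearMap.star_eq_adjoint]
  · rfl

/-- Since `P Tᵢ = 0`, the vector `P* d` is annihilated by every `Tᵢ*`, so only the constant term of
the series survives. -/
theorem evalOp_adjoint_self (hT : ‖adjointPencil T z‖ < 1) (hP : ∀ d, P (P.adjoint d) = d)
    (h : ∀ i x, P (T i x) = 0) (d : D) : evalOp (M + 1) T P z (P.adjoint d) = d := by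
  have h1 := hasSum_evalOp (M := M) (P := P) hT (P.adjoint d)
  have h0 : adjointPencil T z (P.adjoint d) = 0 := by
    rw [adjointPencil_apply]
    refine Finset.sum_eq_zero fun i _ => ?_
    have : (T i).adjoint (P.adjoint d) = 0 := by
      refine ext_inner_right ℂ fun y => ?_
      rw [ContinuousLinearMap.adjoint_inner_left, ContinuousLinearMap.adjoint_inner_left, h]
      simp
    rw [this, smul_zero]
  refine h1.unique ?_
  convert hasSum_single 0 fun k hk => ?_ using 1
  · simp [hP]
  · obtain ⟨j, rfl⟩ := Nat.exists_eq_succ_of_ne_zero hk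
    rw [pow_succ, mul_apply_eq_comp, h0]
    simp

/-- Under `e` the adjoint pencil at `w` acts as the scalar `inner ℂ w z`, so the operator series
becomes the scalar binomial series. The map `e` is left general because it is `evalOp` itself in one
implication and a given point evaluation in the other. -/
theorem apply_adjoint_evalOp {w : EuclideanSpace ℂ (Fin n)} {e : E →L[ℂ] D}
    (he : ∀ i x, e (T i x) = z i • e x) (heP : ∀ d, e (P.adjoint d) = d)
    (hw : ‖adjointPencil T w‖ < 1) (hzw : ‖inner ℂ w z‖ < 1) (d : D) :
    e ((evalOp (M + 1) T P w).adjoint d) = ((1 - inner ℂ w z) ^ (M + 1))⁻¹ • d := by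
  have h1 := (hasSum_adjoint_evalOp (M := M) (P := P) hw d).mapL e
  simp only [map_smul, apply_adjointPencil_adjoint_pow he, heP, smul_smul] at h1
  rw [← one_div]
  exact h1.unique ((hasSum_choose_mul_geometric_of_norm_lt_one M hzw).smul_const d)

end Pencil

/-! ### From the evaluations to their Taylor coefficients -/

section Coefficients

variable {n : ℕ} {E D : Type*} [NormedAddCommGroup E] [InnerProductSpace ℂ E] [CompleteSpace E]
  [NormedAddCommGroup D] [InnerProductSpace ℂ D]
  {M : ℕ} {T : Fin n → E →L[ℂ] E} {P : E →L[ℂ] D}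

theorem eventually_norm_smul_lt {F : Type*} [NormedAddCommGroup F] [NormedSpace ℂ F] (v : F)
    {r : ℝ} (hr : 0 < r) : ∀ᶠ t : ℂ in nhds 0, ‖t • v‖ < r := by
  have h : Continuous fun t : ℂ => ‖t • v‖ := by fun_prop
  exact h.continuousAt.eventually_lt continuousAt_const (by simpa using hr)

theorem pow_eq_zero_of_evalOp_eq_zero (hT : IsRowContraction T) {x : E}
    (h : ∀ z : EuclideanSpace ℂ (Fin n), ‖z‖ < 1 → evalOp (M + 1) T P z x = 0)
    (z : EuclideanSpace ℂ (Fin n)) (k : ℕ) : P ((adjointPencil T z ^ k) x) = 0 := by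
  have key := HasSum.coeff_eq_zero_of_eventually
    (a := fun k => ((k + M).choose M : ℂ) • P ((adjointPencil T z ^ k) x)) (by
      filter_upwards [eventually_norm_smul_lt z one_pos] with t ht
      have hs := hasSum_evalOp (M := M) (P := P) ((hT.norm_adjointPencil_le (t • z)).trans_lt ht) x
      rw [h _ ht] at hs
      convert hs using 2 with j
      rw [adjointPencil_smul, smul_pow, smul_apply, map_smul, smul_comm]) k
  refine (smul_eq_zero.1 key).resolve_left ?_
  exact_mod_cast (Nat.choose_pos (Nat.le_add_left M k)).ne'

theorem evalOp_eq_zero_of_pow_eq_zero {z : EuclideanSpace ℂ (Fin n)}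
    (hT : ‖adjointPencil T z‖ < 1) {x : E}
    (h : ∀ k, P ((adjointPencil T z ^ k) x) = 0) : evalOp (M + 1) T P z x = 0 := by
  have hs := hasSum_evalOp (M := M) (P := P) hT x
  simp only [h, smul_zero] at hs
  exact hs.unique hasSum_zero

theorem shiftRelations_of_evalOp (hT : IsRowContraction T)
    (h : ∀ z : EuclideanSpace ℂ (Fin n), ‖z‖ < 1 → ∀ i x,
      evalOp (M + 1) T P z (T i x) = z i • evalOp (M + 1) T P z x)
    (z : EuclideanSpace ℂ (Fin n)) (N : ℕ) : ShiftRelations M T P z N := by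
  have key : ∀ i x, P (T i x) = 0 ∧ ∀ k,
      ((k + 1 + M).choose M : ℂ) • P ((adjointPencil T z ^ (k + 1)) (T i x)) =
      z i • ((k + M).choose M : ℂ) • P ((adjointPencil T z ^ k) x) := by
    intro i x
    have hk := HasSum.coeff_eq_of_eventually_eq_smul (c := z i)
      (a := fun k => ((k + M).choose M : ℂ) • P ((adjointPencil T z ^ k) (T i x)))
      (b := fun k => ((k + M).choose M : ℂ) • P ((adjointPencil T z ^ k) x)) (by
        filter_upwards [eventually_norm_smul_lt z one_pos] with t ht
        have ht' := (hT.norm_adjointPencil_le (t • z)).trans_lt ht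
        have hs : ∀ y, HasSum (fun k => t ^ k • ((k + M).choose M : ℂ) •
            P ((adjointPencil T z ^ k) y)) (evalOp (M + 1) T P (t • z) y) := fun y => by
          refine (hasSum_evalOp (M := M) (P := P) ht' y).congr_fun fun k => ?_
          rw [adjointPencil_smul, smul_pow, smul_apply, map_smul, smul_comm]
        refine ⟨_, ?_, hs x⟩
        have h1 := hs (T i x)
        rwa [h _ ht] at h1)
    exact ⟨by simpa using hk.1, hk.2⟩
  refine ⟨fun i x => (key i x).1, fun k _ i x => ?_⟩
  rw [(key i x).2 k, smul_smul, mul_comm]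

theorem adjointPencil_add_smul_single (T : Fin n → E →L[ℂ] E) (z : EuclideanSpace ℂ (Fin n))
    (t : ℂ) (i : Fin n) :
    adjointPencil T (z + t • EuclideanSpace.single i 1) =
      t • (T i).adjoint + adjointPencil T z := by
  ext x
  simp only [adjointPencil_apply, add_apply, smul_apply, PiLp.add_apply, PiLp.smul_apply,
    PiLp.single_apply, add_smul, Finset.sum_add_distrib, smul_eq_mul, mul_ite, mul_one, mul_zero,
    ite_smul, zero_smul, Finset.sum_ite_eq', Finset.mem_univ, if_true]
  simp [add_comm]

theorem IsCommutingTuple.commute_adjoint (hT : IsCommutingTuple T) (i j : Fin n) :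
    Commute (T i).adjoint (T j).adjoint :=
  (hT i j).star_star

theorem IsCommutingTuple.commute_adjoint_pencil (hT : IsCommutingTuple T) (i : Fin n)
    (z : EuclideanSpace ℂ (Fin n)) : Commute (T i).adjoint (adjointPencil T z) :=
  Commute.sum_right _ _ _ fun j _ => (hT.commute_adjoint i j).smul_right _

/-- Polarization: by commutativity, the coefficient of `t` in `P A(z + t eᵢ)ᵏ⁺¹ x` is `(k + 1) P
A(z)ᵏ Tᵢ* x`. -/
theorem IsCommutingTuple.pow_adjoint_eq_zero (hT : IsCommutingTuple T) {x : E}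
    (h : ∀ z k, P ((adjointPencil T z ^ k) x) = 0) (i : Fin n)
    (z : EuclideanSpace ℂ (Fin n)) (k : ℕ) :
    P ((adjointPencil T z ^ k) ((T i).adjoint x)) = 0 := by
  have hc := hT.commute_adjoint_pencil i z
  have key := HasSum.coeff_eq_zero_of_eventually
    (a := fun j => ((k + 1).choose j : ℂ) •
      P (((T i).adjoint ^ j * adjointPencil T z ^ (k + 1 - j)) x)) (by
    refine Filter.Eventually.of_forall fun t => ?_
    have h0 := h (z + t • EuclideanSpace.single i 1) (k + 1)
    rw [adjointPencil_add_smul_single, (hc.smul_left t).add_pow] at h0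
    rw [← h0, sum_apply, map_sum]
    have hs : HasSum (fun j => t ^ j • ((k + 1).choose j : ℂ) •
        P (((T i).adjoint ^ j * adjointPencil T z ^ (k + 1 - j)) x)) _ :=
      hasSum_sum_of_ne_finset_zero (s := Finset.range (k + 1 + 1)) fun j hj => by
        rw [Nat.choose_eq_zero_of_lt (by simpa using hj)]
        simp
    convert hs using 1
    refine Finset.sum_congr rfl fun j _ => ?_
    rw [← nsmul_eq_mul', ← Nat.cast_smul_eq_nsmul ℂ, smul_apply, map_smul, smul_pow,
      smul_mul_assoc, smul_apply, map_smul, smul_comm]) 1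
  rw [Nat.choose_one_right, pow_one, Nat.add_sub_cancel, (hc.pow_right k).eq] at key
  refine (smul_eq_zero.1 key).resolve_left ?_
  exact_mod_cast k.succ_ne_zero

end Coefficients

/-! ### Consequences of the operator identity -/

section Forward

variable {n : ℕ} {E : Type*} [NormedAddCommGroup E] [InnerProductSpace ℂ E] [CompleteSpace E]
  {M : ℕ} {T : Fin n → E →L[ℂ] E}

instance completeSpace_wanderingSubspace (T : Fin n → E →L[ℂ] E) :
    CompleteSpace (wanderingSubspace T) :=
  inferInstanceAs (CompleteSpace (rowOp T).rangeᗮ)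

/-- The orthogonal projection onto the wandering subspace. -/
noncomputable def wanderingProj (T : Fin n → E →L[ℂ] E) : E →L[ℂ] wanderingSubspace T :=
  (wanderingSubspace T).orthogonalProjectionOnto

theorem wanderingProj_tuple (T : Fin n → E →L[ℂ] E) (i : Fin n) (x : E) :
    wanderingProj T (T i x) = 0 := by
  rw [wanderingProj, Submodule.orthogonalProjectionOnto_eq_zero_iff]
  exact Submodule.le_orthogonal_orthogonal _ ⟨PiLp.single 2 i x, rowOp_single T i x⟩

theorem wanderingProj_adjoint_apply (T : Fin n → E →L[ℂ] E) (d : wanderingSubspace T) :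
    (wanderingProj T).adjoint d = d := by
  refine ext_inner_right ℂ fun y => ?_
  rw [ContinuousLinearMap.adjoint_inner_left]
  exact Submodule.inner_orthogonalProjectionOnto_eq_of_mem_left d y

theorem wanderingProj_adjoint (T : Fin n → E →L[ℂ] E) (d : wanderingSubspace T) :
    wanderingProj T ((wanderingProj T).adjoint d) = d := by
  rw [wanderingProj_adjoint_apply, wanderingProj,
    Submodule.orthogonalProjectionOnto_mem_subspace_eq_self]

theorem mem_wanderingSubspace_of_adjoint_eq_zero {x : E} (h : (rowOp T).adjoint x = 0) :
    x ∈ wanderingSubspace T := by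
  rintro _ ⟨y, rfl⟩
  have := ContinuousLinearMap.adjoint_inner_right (rowOp T) y x
  rw [h, inner_zero_right] at this
  exact this.symm

/-- The vector `σ(Δ) x = T(⊕Δ)T* x` lies in the range of `T` and has the same image under `T*` as
`x`; hence the difference lies in `ker T* = W(T)`. -/
theorem InverseIdentity.wanderingProj_apply {m : ℕ} (h : InverseIdentity m T) (x : E) :
    (wanderingProj T x : E) = x - sigmaMap T (deltaOp m T) x := by
  have h2 := (h _ ⟨x, rfl⟩).2.1
  rw [ContinuousLinearMap.coe_coe, rowOp_ampliation_adjoint] at h2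
  have hmem : x - sigmaMap T (deltaOp m T) x ∈ wanderingSubspace T :=
    mem_wanderingSubspace_of_adjoint_eq_zero (by rw [map_sub, h2, sub_self])
  have h0 : wanderingProj T (sigmaMap T (deltaOp m T) x) = 0 := by
    rw [sigmaMap_apply, map_sum]
    exact Finset.sum_eq_zero fun i _ => wanderingProj_tuple T i _
  have hx : wanderingProj T x = wanderingProj T (x - sigmaMap T (deltaOp m T) x) := by
    rw [map_sub, h0, sub_zero]
  rw [hx, wanderingProj]
  exact congrArg Subtype.val
    (Submodule.orthogonalProjectionOnto_mem_subspace_eq_self (⟨_, hmem⟩ : wanderingSubspace T))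

/-- The pencil `∑ᵢ zᵢ Lᵢ` of the left inverse `L = (⊕Δ) T*` of the row operator. -/
noncomputable def leftInversePencil (m : ℕ) (T : Fin n → E →L[ℂ] E)
    (z : EuclideanSpace ℂ (Fin n)) : E →L[ℂ] E :=
  deltaOp m T ∘L adjointPencil T z

theorem leftInversePencil_smul (m : ℕ) (T : Fin n → E →L[ℂ] E) (t : ℂ)
    (z : EuclideanSpace ℂ (Fin n)) :
    leftInversePencil m T (t • z) = t • leftInversePencil m T z := by
  simp [leftInversePencil, adjointPencil_smul]

theorem InverseIdentity.sub_mem_range {m : ℕ} (h : InverseIdentity m T)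
    (z : EuclideanSpace ℂ (Fin n)) (x : E) :
    x - leftInversePencil m T z x - wanderingProj T x ∈ (rowOp T - scalarRow E z).range := by
  -- On this witness `T` gives `σ(Δ) x = x - P x`, and `Z` gives the left inverse pencil applied to
  -- `x`.
  refine ⟨ampliation n (deltaOp m T) ((rowOp T).adjoint x), ?_⟩
  rw [h.wanderingProj_apply, ContinuousLinearMap.coe_coe, sub_apply,
    rowOp_ampliation_adjoint, scalarRow_apply, leftInversePencil, ContinuousLinearMap.comp_apply,
    adjointPencil_apply]
  simp only [ampliation_apply, rowOp_adjoint_apply, map_sum, map_smul]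
  abel

/-- With `S = (1 - ΔA(z))⁻¹`, the previous lemma at `S u` puts `u - P S u` in the range of `T - Z`.
If `u` is in that range, so is `P S u`, and directness of the sum forces `P S u = 0`. Apply this to
`u = Tᵢ x - zᵢ x`. -/
theorem InverseIdentity.wanderingProj_inverse_tuple {m : ℕ} (h : InverseIdentity m T)
    {z : EuclideanSpace ℂ (Fin n)}
    (hz : Disjoint (rowOp T - scalarRow E z).range (wanderingSubspace T))
    (hL : ‖leftInversePencil m T z‖ < 1) (i : Fin n) (x : E) :
    wanderingProj T (Ring.inverse (1 - leftInversePencil m T z) (T i x)) =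
      z i • wanderingProj T (Ring.inverse (1 - leftInversePencil m T z) x) := by
  set S := Ring.inverse (1 - leftInversePencil m T z)
  have hu : IsUnit (1 - leftInversePencil m T z) := isUnit_one_sub_of_norm_lt_one hL
  have hmem : ∀ u, u ∈ (rowOp T - scalarRow E z).range → wanderingProj T (S u) = 0 := by
    intro u hmu
    have h1 := h.sub_mem_range z (S u)
    have h2 : S u - leftInversePencil m T z (S u) = u := by
      have := congrArg (fun A : E →L[ℂ] E => A u) (Ring.mul_inverse_cancel _ hu)
      simpa using this
    rw [h2] at h1
    have h3 := Submodule.sub_mem _ hmu h1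
    rw [sub_sub_cancel] at h3
    have := Submodule.disjoint_def.1 hz _ h3 (wanderingProj T (S u)).2
    exact Subtype.ext this
  have := hmem _ (tuple_sub_mem_range T z i x)
  rw [map_sub, map_sub, map_smul, map_smul] at this
  exact sub_eq_zero.1 this

theorem InverseIdentity.wanderingProj_pow_tuple {m : ℕ} (h : InverseIdentity m T)
    (hreg : IsRegularAtZero T) (z : EuclideanSpace ℂ (Fin n)) (i : Fin n) (x : E) (k : ℕ) :
    wanderingProj T ((leftInversePencil m T z ^ (k + 1)) (T i x)) =
      z i • wanderingProj T ((leftInversePencil m T z ^ k) x) := by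
  obtain ⟨ε, hε, hreg⟩ := hreg
  refine (HasSum.coeff_eq_of_eventually_eq_smul (c := z i)
    (a := fun k => wanderingProj T ((leftInversePencil m T z ^ k) (T i x)))
    (b := fun k => wanderingProj T ((leftInversePencil m T z ^ k) x)) ?_).2 k
  filter_upwards [eventually_norm_smul_lt z hε,
    eventually_norm_smul_lt (leftInversePencil m T z) one_pos] with t ht1 ht2
  rw [← leftInversePencil_smul] at ht2
  have hs : ∀ y, HasSum (fun k => t ^ k • wanderingProj T ((leftInversePencil m T z ^ k) y))
      (wanderingProj T (Ring.inverse (1 - leftInversePencil m T (t • z)) y)) := fun y => by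
    have h1 := ((hasSum_geom_series_inverse _ ht2).mapL
      (ContinuousLinearMap.apply ℂ E y)).mapL (wanderingProj T)
    refine h1.congr_fun fun k => ?_
    rw [leftInversePencil_smul, smul_pow, map_smul, map_smul]
    rfl
  refine ⟨_, ?_, hs x⟩
  have h1 := hs (T i x)
  rwa [h.wanderingProj_inverse_tuple (hreg _ ht1).2.disjoint ht2] at h1

/-- The relations below degree `N` and the formula `P (ΔA)^N = c_N P A^N` are proved together: the
relations let `Δ` be absorbed, which gives the formula in degree `N + 1`, and inserting it into
`InverseIdentity.wanderingProj_pow_tuple` gives the missing relation. -/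
theorem InverseIdentity.shiftRelations (h : InverseIdentity (M + 1) T) (hreg : IsRegularAtZero T)
    (z : EuclideanSpace ℂ (Fin n)) (N : ℕ) : ShiftRelations M T (wanderingProj T) z N := by
  suffices H : ShiftRelations M T (wanderingProj T) z N ∧ ∀ x,
      wanderingProj T ((leftInversePencil (M + 1) T z ^ N) x) =
        ((N + M).choose M : ℂ) • wanderingProj T ((adjointPencil T z ^ N) x) from H.1
  induction N with
  | zero => exact ⟨⟨wanderingProj_tuple T, fun k hk => absurd hk k.not_lt_zero⟩, by simp⟩
  | succ N ih =>
    obtain ⟨hR, hV⟩ := ih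
    have hV' : ∀ x, wanderingProj T ((leftInversePencil (M + 1) T z ^ (N + 1)) x) =
        ((N + 1 + M).choose M : ℂ) • wanderingProj T ((adjointPencil T z ^ (N + 1)) x) := by
      intro x
      rw [pow_succ, mul_apply_eq_comp, hV, leftInversePencil, ContinuousLinearMap.comp_apply,
        hR.pow_deltaOp, pow_succ, mul_apply_eq_comp]
    refine ⟨⟨hR.1, fun k hk i x => ?_⟩, hV'⟩
    rcases Nat.lt_succ_iff_lt_or_eq.1 hk with hk | rfl
    · exact hR.2 k hk i x
    · rw [← hV', h.wanderingProj_pow_tuple hreg, hV, smul_smul, mul_comm]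

end Forward

/-! ### Spherical coisometries -/

section Coisometry

/-- A contraction has no nontrivial Jordan block at the eigenvalue `1`: if `(1 - σ)² w = 0`, then
`σᴺ w = w - N (w - σ w)` would grow linearly unless `σ w = w`. -/
theorem apply_eq_self_of_one_sub_pow_apply_eq_zero {V : Type*} [NormedAddCommGroup V]
    [NormedSpace ℂ V] (σ : Module.End ℂ V) (hσ : ∀ v, ‖σ v‖ ≤ ‖v‖) {v : V} (k : ℕ)
    (h : ((1 - σ) ^ (k + 1)) v = 0) : σ v = v := by
  have step : ∀ w, (1 - σ) ((1 - σ) w) = 0 → (1 - σ) w = 0 := by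
    intro w hw
    have h1 : σ (w - σ w) = w - σ w :=
      (sub_eq_zero.1 (show w - σ w - σ (w - σ w) = 0 from hw)).symm
    have h2 : ∀ N : ℕ, (σ ^ N) w = w - (N : ℂ) • (w - σ w) := by
      intro N
      induction N with
      | zero => simp
      | succ N ih =>
        rw [pow_succ', Module.End.mul_apply, ih, map_sub, map_smul, h1, Nat.cast_succ, add_smul, one_smul]
        abel
    have h3 : ∀ N : ℕ, ‖(σ ^ N) w‖ ≤ ‖w‖ := by
      intro N
      induction N with
      | zero => simp
      | succ N ih =>
        rw [pow_succ', Module.End.mul_apply]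
        exact (hσ _).trans ih
    have h4 : ∀ N : ℕ, (N : ℝ) * ‖w - σ w‖ ≤ 2 * ‖w‖ := by
      intro N
      have e : (N : ℂ) • (w - σ w) = w - (σ ^ N) w := by rw [h2]; abel
      have := norm_sub_le w ((σ ^ N) w)
      rw [← e, norm_smul, Complex.norm_natCast] at this
      linarith [h3 N]
    by_contra hne
    have hpos : 0 < ‖w - σ w‖ := norm_pos_iff.2 (by simpa using hne)
    obtain ⟨N, hN⟩ := exists_nat_gt (2 * ‖w‖ / ‖w - σ w‖)
    rw [div_lt_iff₀ hpos] at hN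
    exact absurd (h4 N) (not_le.2 hN)
  induction k with
  | zero =>
    rw [zero_add, pow_one] at h
    exact (sub_eq_zero.1 (show v - σ v = 0 from h)).symm
  | succ k ih =>
    refine ih ?_
    rw [pow_succ', Module.End.mul_apply] at h ⊢
    refine step _ ?_
    rwa [pow_succ', Module.End.mul_apply] at h

variable {n : ℕ} {E : Type*} [NormedAddCommGroup E] [InnerProductSpace ℂ E] [CompleteSpace E]
  {T : Fin n → E →L[ℂ] E}

/-- The map `σ_T` as a linear map. -/
noncomputable def sigmaHom (T : Fin n → E →L[ℂ] E) : Module.End ℂ (E →L[ℂ] E) where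
  toFun := sigmaMap T
  map_add' X Y := by
    ext x
    simp [sigmaMap_apply, Finset.sum_add_distrib]
  map_smul' c X := by
    ext x
    simp [sigmaMap_apply, Finset.smul_sum]

theorem sigmaHom_apply (T : Fin n → E →L[ℂ] E) (X : E →L[ℂ] E) :
    sigmaHom T X = sigmaMap T X := rfl

theorem sigmaHom_pow_apply (T : Fin n → E →L[ℂ] E) (j : ℕ) (X : E →L[ℂ] E) :
    (sigmaHom T ^ j) X = (sigmaMap T)^[j] X := by
  rw [Module.End.pow_apply]
  rfl

/-- In the binomial expansion everything beyond the constant term has a factor `σ`; extracting it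
leaves `-Δ`. -/
theorem one_sub_sigmaHom_pow_id (M : ℕ) (T : Fin n → E →L[ℂ] E) :
    ((1 - sigmaHom T) ^ (M + 1)) (ContinuousLinearMap.id ℂ E) =
      ContinuousLinearMap.id ℂ E - sigmaMap T (deltaOp (M + 1) T) := by
  have hpow : (1 - sigmaHom T) ^ (M + 1) = ∑ i ∈ Finset.range (M + 2),
      ((-1 : ℂ) ^ i * ((M + 1).choose i : ℂ)) • sigmaHom T ^ i := by
    rw [sub_eq_add_neg, add_comm, (Commute.one_right (-sigmaHom T)).add_pow]
    refine Finset.sum_congr rfl fun i _ => ?_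
    rw [one_pow, mul_one, ← nsmul_eq_mul', ← Nat.cast_smul_eq_nsmul ℂ, ← neg_one_smul ℂ, smul_pow,
      smul_smul, mul_comm]
  rw [hpow, Finset.sum_range_succ', ← sigmaHom_apply, deltaOp, map_sum, LinearMap.add_apply,
    LinearMap.sum_apply, sub_eq_neg_add, ← Finset.sum_neg_distrib]
  congr 1
  · refine Finset.sum_congr rfl fun i _ => ?_
    rw [map_smul, ← sigmaHom_pow_apply, ← Module.End.mul_apply, ← pow_succ', LinearMap.smul_apply,
      ← neg_smul, pow_succ]
    congr 1
    ring
  · simp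

theorem IsRowContraction.norm_sigmaMap_le (hT : IsRowContraction T) (X : E →L[ℂ] E) :
    ‖sigmaMap T X‖ ≤ ‖X‖ := by
  have hT' : ‖(rowOp T).adjoint‖ ≤ 1 := by rwa [LinearIsometryEquiv.norm_map]
  refine ContinuousLinearMap.opNorm_le_bound _ (norm_nonneg _) fun x => ?_
  rw [← rowOp_ampliation_adjoint]
  calc _ ≤ ‖ampliation n X ((rowOp T).adjoint x)‖ :=
        ((rowOp T).le_of_opNorm_le hT _).trans_eq (one_mul _)
    _ ≤ ‖X‖ * ‖(rowOp T).adjoint x‖ := norm_ampliation_apply_le X _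
    _ ≤ ‖X‖ * ‖x‖ := mul_le_mul_of_nonneg_left
        (((rowOp T).adjoint.le_of_opNorm_le hT' x).trans_eq (one_mul _)) (norm_nonneg _)

/-- The subspace is invariant under the tuple and its adjoint. -/
def IsReducing (T : Fin n → E →L[ℂ] E) (K : Submodule ℂ E) : Prop :=
  (∀ i, ∀ x ∈ K, T i x ∈ K) ∧ ∀ i, ∀ x ∈ K, (T i).adjoint x ∈ K

variable {K : Submodule ℂ E}

theorem IsReducing.orthogonal (h : IsReducing T K) : IsReducing T Kᗮ := by
  refine ⟨fun i y hy x hx => ?_, fun i y hy x hx => ?_⟩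
  · rw [← ContinuousLinearMap.adjoint_inner_left]
    exact hy _ (h.2 i x hx)
  · rw [ContinuousLinearMap.adjoint_inner_right]
    exact hy _ (h.1 i x hx)

theorem IsReducing.adjoint_starProjection [K.HasOrthogonalProjection] (h : IsReducing T K)
    (i : Fin n) (x : E) :
    (T i).adjoint (K.starProjection x) = K.starProjection ((T i).adjoint x) :=
  apply_starProjection_of_invariant (h.2 i) (h.orthogonal.2 i) x

theorem IsReducing.sigmaMap_iterate_starProjection [K.HasOrthogonalProjection]
    (h : IsReducing T K) (j : ℕ) (X : E →L[ℂ] E) :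
    (sigmaMap T)^[j] (X ∘L K.starProjection) = (sigmaMap T)^[j] X ∘L K.starProjection := by
  induction j generalizing X with
  | zero => rfl
  | succ j ih =>
    rw [Function.iterate_succ_apply, Function.iterate_succ_apply, ← ih]
    congr 1
    ext x
    simp only [sigmaMap_apply, ContinuousLinearMap.comp_apply, h.adjoint_starProjection]

/-- Let `Q` be the projection onto `K`. The hypothesis says that `(1 - σ)^(M+1)` annihilates `Q`,
and since `σ` is a contraction, `σ(Q) = Q`. -/
theorem IsReducing.sum_apply_adjoint_eq [K.HasOrthogonalProjection] (h : IsReducing T K)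
    (hT : IsRowContraction T) (M : ℕ)
    (hK : ∀ x ∈ K, sigmaMap T (deltaOp (M + 1) T) x = x) {x : E} (hx : x ∈ K) :
    ∑ i, T i ((T i).adjoint x) = x := by
  have key : ((1 - sigmaHom T) ^ (M + 1)) K.starProjection = 0 := by
    -- Because `K` reduces `T`, `σ` commutes with right multiplication by the projection, and so
    -- does every polynomial in `σ`.
    have hcomp : ∀ p : Polynomial ℂ, Polynomial.aeval (sigmaHom T) p K.starProjection =
        Polynomial.aeval (sigmaHom T) p (ContinuousLinearMap.id ℂ E) ∘L K.starProjection := by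
      intro p
      induction p using Polynomial.induction_on' with
      | add p q hp hq =>
        rw [map_add, LinearMap.add_apply, LinearMap.add_apply, hp, hq,
          ContinuousLinearMap.add_comp]
      | monomial j c =>
        rw [Polynomial.aeval_monomial]
        simp only [Module.End.mul_apply, Module.algebraMap_end_apply, sigmaHom_pow_apply]
        rw [ContinuousLinearMap.smul_comp, ← h.sigmaMap_iterate_starProjection,
          ContinuousLinearMap.id_comp]
    have h1 := hcomp ((1 - Polynomial.X) ^ (M + 1))
    rw [map_pow, map_sub, map_one, Polynomial.aeval_X, one_sub_sigmaHom_pow_id] at h1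
    rw [h1]
    ext y
    simp [hK _ (Submodule.starProjection_apply_mem K y)]
  have h1 := apply_eq_self_of_one_sub_pow_apply_eq_zero (sigmaHom T)
    (fun X => hT.norm_sigmaMap_le X) M key
  have h2 := congrArg (fun A : E →L[ℂ] E => A x) h1
  simp only [sigmaHom_apply, sigmaMap_apply, ← h.adjoint_starProjection] at h2
  rwa [Submodule.starProjection_eq_self_iff.2 hx] at h2

theorem adjoint_restrict_apply [CompleteSpace K] {A : E →L[ℂ] E} {A₀ : K →L[ℂ] K}
    (h₀ : ∀ x : K, A x = A₀ x) (h₁ : ∀ y ∈ Kᗮ, A y ∈ Kᗮ) (x : K) :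
    (A₀.adjoint x : E) = A.adjoint x := by
  refine ext_inner_right ℂ fun y => ?_
  rw [ContinuousLinearMap.adjoint_inner_left]
  obtain ⟨u, hu, v, hv, rfl⟩ := K.exists_add_mem_mem_orthogonal y
  rw [map_add, inner_add_right, inner_add_right, h₁ v hv x x.2, hv _ (A₀.adjoint x).2,
    h₀ ⟨u, hu⟩, ← Submodule.coe_inner K x]
  congr 1
  exact ContinuousLinearMap.adjoint_inner_left A₀ ⟨u, hu⟩ x

end Coisometry

/-! ### The Wold decomposition -/

section Wold

variable {n : ℕ} {E : Type*} [NormedAddCommGroup E] [InnerProductSpace ℂ E] [CompleteSpace E]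
  {M : ℕ} {T : Fin n → E →L[ℂ] E}

theorem norm_inner_unitBall_lt_one (w z : UnitBall n) :
    ‖inner ℂ (w : EuclideanSpace ℂ (Fin n)) (z : EuclideanSpace ℂ (Fin n))‖ < 1 := by
  have hz : ‖(z : EuclideanSpace ℂ (Fin n))‖ < 1 := mem_ball_zero_iff.1 z.2
  have hw : ‖(w : EuclideanSpace ℂ (Fin n))‖ < 1 := mem_ball_zero_iff.1 w.2
  exact (norm_inner_le_norm _ _).trans_lt (mul_lt_one_of_nonneg_of_lt_one_left (norm_nonneg _) hw
    hz.le)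

theorem IsRowContraction.norm_adjointPencil_lt_one (hT : IsRowContraction T) (z : UnitBall n) :
    ‖adjointPencil T z‖ < 1 :=
  (hT.norm_adjointPencil_le _).trans_lt (mem_ball_zero_iff.1 z.2)

theorem opKernel_apply (m : ℕ) (D : Type*) [NormedAddCommGroup D] [InnerProductSpace ℂ D]
    (z w : UnitBall n) (d : D) : opKernel n m D z w d =
      ((1 - inner ℂ (w : EuclideanSpace ℂ (Fin n)) (z : EuclideanSpace ℂ (Fin n))) ^ m)⁻¹ • d := by
  simp [opKernel, scalarKernel]

/-- The common kernel of the evaluations `P (1 - ∑ᵢ zᵢTᵢ*)⁻ᵐ` with `P` the projection onto the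
wandering subspace. -/
noncomputable def coisometricPart (m : ℕ) (T : Fin n → E →L[ℂ] E) : Submodule ℂ E :=
  ⨅ z : UnitBall n, (evalOp m T (wanderingProj T) z).ker

theorem mem_coisometricPart {m : ℕ} {x : E} :
    x ∈ coisometricPart m T ↔ ∀ z : UnitBall n, evalOp m T (wanderingProj T) z x = 0 := by
  simp [coisometricPart]

theorem isClosed_coisometricPart (m : ℕ) (T : Fin n → E →L[ℂ] E) :
    IsClosed (coisometricPart m T : Set E) := by
  rw [coisometricPart, Submodule.coe_iInf]
  exact isClosed_iInter fun z => ContinuousLinearMap.isClosed_ker _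

theorem IsRowContraction.mem_coisometricPart_iff (hT : IsRowContraction T) {x : E} :
    x ∈ coisometricPart (M + 1) T ↔
      ∀ z k, wanderingProj T ((adjointPencil T z ^ k) x) = 0 := by
  rw [mem_coisometricPart]
  refine ⟨fun h => pow_eq_zero_of_evalOp_eq_zero hT fun z hz => h ⟨z, mem_ball_zero_iff.2 hz⟩,
    fun h z => evalOp_eq_zero_of_pow_eq_zero (hT.norm_adjointPencil_lt_one z) (h z)⟩

theorem InverseIdentity.evalOp_tuple (h : InverseIdentity (M + 1) T) (hT : IsRowContraction T)
    (hreg : IsRegularAtZero T) (z : UnitBall n) (i : Fin n) (x : E) :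
    evalOp (M + 1) T (wanderingProj T) z (T i x) =
      (z : EuclideanSpace ℂ (Fin n)) i • evalOp (M + 1) T (wanderingProj T) z x :=
  evalOp_apply_tuple (hT.norm_adjointPencil_lt_one z) (h.shiftRelations hreg _) i x

/-- Invariance under `Tᵢ` is visible from the evaluations, invariance under `Tᵢ*` from their
homogeneous Taylor coefficients. -/
theorem InverseIdentity.isReducing_coisometricPart (h : InverseIdentity (M + 1) T)
    (hcomm : IsCommutingTuple T) (hT : IsRowContraction T) (hreg : IsRegularAtZero T) :
    IsReducing T (coisometricPart (M + 1) T) := by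
  refine ⟨fun i x hx => ?_, fun i x hx => ?_⟩
  · rw [mem_coisometricPart] at hx ⊢
    intro z
    rw [h.evalOp_tuple hT hreg, hx, smul_zero]
  · rw [hT.mem_coisometricPart_iff] at hx ⊢
    exact hcomm.pow_adjoint_eq_zero hx i

theorem InverseIdentity.sigmaMap_deltaOp_of_mem (h : InverseIdentity (M + 1) T)
    (hT : IsRowContraction T) {x : E} (hx : x ∈ coisometricPart (M + 1) T) :
    sigmaMap T (deltaOp (M + 1) T) x = x := by
  have h0 := hT.mem_coisometricPart_iff.1 hx 0 0
  rw [pow_zero, one_apply_eq_self] at h0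
  have h1 := h.wanderingProj_apply x
  rw [h0, Submodule.coe_zero] at h1
  exact (sub_eq_zero.1 h1.symm).symm

theorem InverseIdentity.exists_unitary_ballSpace (h : InverseIdentity (M + 1) T)
    (hT : IsRowContraction T) (hreg : IsRegularAtZero T) :
    ∃ U : (coisometricPart (M + 1) T)ᗮ ≃ₗᵢ[ℂ] BallSpace n (M + 1) (wanderingSubspace T),
      ∀ x z, U x z = evalOp (M + 1) T (wanderingProj T) z x := by
  have := (isClosed_coisometricPart (M + 1) T).completeSpace_coe
  set K := coisometricPart (M + 1) T
  have hmem : ∀ (w : UnitBall n) d, (evalOp (M + 1) T (wanderingProj T) w).adjoint d ∈ Kᗮ := by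
    intro w d x hx
    rw [ContinuousLinearMap.adjoint_inner_right, mem_coisometricPart.1 hx, inner_zero_left]
  refine exists_linearIsometryEquiv_ofKernel (opKernel n (M + 1) (wanderingSubspace T))
    (fun z : UnitBall n => evalOp (M + 1) T (wanderingProj T) z ∘L Kᗮ.subtypeL)
    (fun z w => ?_) (fun x hx => ?_)
  · refine ContinuousLinearMap.ext fun d => ?_
    rw [ContinuousLinearMap.adjoint_comp, Submodule.adjoint_subtypeL, opKernel_apply]
    have e : ((Kᗮ.orthogonalProjectionOnto
        ((evalOp (M + 1) T (wanderingProj T) w).adjoint d) : Kᗮ) : E) =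
        (evalOp (M + 1) T (wanderingProj T) w).adjoint d :=
      Submodule.starProjection_eq_self_iff.2 (hmem w d)
    simp only [ContinuousLinearMap.comp_apply, Submodule.subtypeL_apply, e]
    exact apply_adjoint_evalOp (h.evalOp_tuple hT hreg z)
      (evalOp_adjoint_self (hT.norm_adjointPencil_lt_one z) (wanderingProj_adjoint T)
        (wanderingProj_tuple T)) (hT.norm_adjointPencil_lt_one w)
      (norm_inner_unitBall_lt_one w z) d
  · have hx' : (x : E) ∈ K := mem_coisometricPart.2 hx
    exact Subtype.ext (inner_self_eq_zero.1 (x.2 _ hx'))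

/-- The operator identity yields the Wold decomposition. -/
theorem InverseIdentity.exists_wold {H : Type u} [NormedAddCommGroup H] [InnerProductSpace ℂ H]
    [CompleteSpace H] {T : Fin n → H →L[ℂ] H} (h : InverseIdentity (M + 1) T)
    (hcomm : IsCommutingTuple T) (hT : IsRowContraction T) (hreg : IsRegularAtZero T) :
    ∃ (H₀ : Submodule ℂ H) (_ : CompleteSpace H₀)
      (T₀ : Fin n → H₀ →L[ℂ] H₀) (T₁ : Fin n → H₀ᗮ →L[ℂ] H₀ᗮ),
      (∀ (i : Fin n) (x : H₀), T i x = T₀ i x) ∧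
      (∀ (i : Fin n) (x : H₀ᗮ), T i x = T₁ i x) ∧
      IsSphericalCoisometry T₀ ∧
      ∃ (D : Type u) (_ : NormedAddCommGroup D) (_ : InnerProductSpace ℂ D)
        (_ : CompleteSpace D), IsUnitarilyEquivalentToShift (M + 1) D T₁ := by
  have hc := (isClosed_coisometricPart (M + 1) T).completeSpace_coe
  have hr := h.isReducing_coisometricPart hcomm hT hreg
  obtain ⟨U, hU⟩ := h.exists_unitary_ballSpace hT hreg
  have hsum := fun x hx => hr.sum_apply_adjoint_eq hT M
    (fun x hx => h.sigmaMap_deltaOp_of_mem hT hx) (x := x) hx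
  generalize coisometricPart (M + 1) T = K at hc hr U hU hsum
  set T₀ : Fin n → K →L[ℂ] K := fun i =>
    (T i ∘L K.subtypeL).codRestrict K fun x => hr.1 i x x.2
  set T₁ : Fin n → Kᗮ →L[ℂ] Kᗮ := fun i =>
    (T i ∘L Kᗮ.subtypeL).codRestrict Kᗮ fun x => hr.orthogonal.1 i x x.2
  have h₀ : ∀ (i : Fin n) (x : K), T i x = T₀ i x := fun i x => rfl
  have h₁ : ∀ (i : Fin n) (x : Kᗮ), T i x = T₁ i x := fun i x => rfl
  have hcomm₀ : IsCommutingTuple T₀ := fun i j => by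
    refine ContinuousLinearMap.ext fun x => Subtype.ext ?_
    exact congrArg (fun A : H →L[ℂ] H => A x) (hcomm i j).eq
  refine ⟨K, hc, T₀, T₁, h₀, h₁, ⟨hcomm₀, fun i j => hcomm₀.commute_adjoint i j, ?_⟩,
    wanderingSubspace T, inferInstance, inferInstance, inferInstance, U, fun i x z => ?_⟩
  · refine ContinuousLinearMap.ext fun x => Subtype.ext ?_
    rw [sum_apply, Submodule.coe_sum, ContinuousLinearMap.id_apply]
    refine (Finset.sum_congr rfl fun i _ => ?_).trans (hsum x x.2)
    rw [ContinuousLinearMap.adjoint_adjoint, ContinuousLinearMap.comp_apply, ← h₀,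
      adjoint_restrict_apply (h₀ i) (hr.orthogonal.1 i)]
  · rw [hU, hU, ← h₁, h.evalOp_tuple hT hreg]

end Wold

/-! ### The operator identity for decomposable tuples -/

section Converse

variable {n : ℕ} {E : Type*} [NormedAddCommGroup E] [InnerProductSpace ℂ E] [CompleteSpace E]

/-- If `A` has closed range, then `A A*` maps onto the range of `A`, up to the kernel of `A*`. -/
theorem exists_adjoint_apply_self_adjoint_eq {F : Type*} [NormedAddCommGroup F]
    [InnerProductSpace ℂ F] [CompleteSpace F] (A : F →L[ℂ] E) (hA : IsClosed (A.range : Set E))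
    (h : E) : ∃ h', A.adjoint (A (A.adjoint h')) = A.adjoint h := by
  have : CompleteSpace A.range := hA.completeSpace_coe
  set B : F →L[ℂ] A.range := A.rangeRestrict
  have hAB : A = A.range.subtypeL ∘L B := rfl
  have hadj : A.adjoint = B.adjoint ∘L A.range.orthogonalProjectionOnto := by
    rw [← Submodule.adjoint_subtypeL, ← ContinuousLinearMap.adjoint_comp, ← hAB]
  have hsurj : Function.Surjective B := by
    rintro ⟨_, x, rfl⟩
    exact ⟨x, rfl⟩
  -- The open mapping theorem bounds `B*` below by `1/C`, whence `B B*` is invertible.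
  obtain ⟨C, hC, hpre⟩ := B.exists_preimage_norm_le hsurj
  have hbelow : ∀ r, ‖r‖ ≤ C * ‖B.adjoint r‖ := by
    intro r
    obtain ⟨x, hx, hxn⟩ := hpre r
    rcases (norm_nonneg r).eq_or_lt with h0 | h0
    · rw [← h0]
      positivity
    have h1 : ‖r‖ * ‖r‖ ≤ (C * ‖B.adjoint r‖) * ‖r‖ := by
      have h2 : inner ℂ r r = inner ℂ x (B.adjoint r) := by
        rw [ContinuousLinearMap.adjoint_inner_right, hx]
      have h3 : ‖r‖ * ‖r‖ = ‖(inner ℂ r r : ℂ)‖ := by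
        rw [inner_self_eq_norm_sq_to_K]
        simp [sq]
      rw [h3, h2]
      refine (norm_inner_le_norm _ _).trans ?_
      nlinarith [norm_nonneg (B.adjoint r)]
    exact le_of_mul_le_mul_right h1 h0
  have hunit : IsUnit (B ∘L B.adjoint) := by
    refine ContinuousLinearMap.isUnit_of_forall_le_norm_inner_map _
      (c := ⟨(C ^ 2)⁻¹, by positivity⟩) (by exact_mod_cast (show 0 < (C ^ 2)⁻¹ by positivity))
      fun r => ?_
    have h1 : ‖(inner ℂ ((B ∘L B.adjoint) r) r : ℂ)‖ = ‖B.adjoint r‖ ^ 2 := by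
      rw [ContinuousLinearMap.comp_apply, ← ContinuousLinearMap.adjoint_inner_right,
        inner_self_eq_norm_sq_to_K]
      simp
    rw [h1]
    change ‖r‖ ^ 2 * (C ^ 2)⁻¹ ≤ _
    rw [← div_eq_mul_inv, div_le_iff₀ (by positivity), mul_comm, ← mul_pow]
    exact pow_le_pow_left₀ (norm_nonneg _) (hbelow r) 2
  -- Solving only for the projection of `h` suffices, since `A*` annihilates the orthogonal
  -- complement of the range.
  obtain ⟨r, hr⟩ := (ContinuousLinearMap.isUnit_iff_bijective.1 hunit).2
    (A.range.orthogonalProjectionOnto h)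
  refine ⟨r, ?_⟩
  have h1 : A.adjoint (r : E) = B.adjoint r := by
    rw [hadj, ContinuousLinearMap.comp_apply,
      Submodule.orthogonalProjectionOnto_mem_subspace_eq_self]
  have h2 : A (B.adjoint r) = ((B ∘L B.adjoint) r : E) := rfl
  rw [h1, h2, hr]
  conv_rhs => rw [hadj]
  conv_lhs => rw [hadj]
  rw [ContinuousLinearMap.comp_apply, ContinuousLinearMap.comp_apply,
    Submodule.orthogonalProjectionOnto_mem_subspace_eq_self]

variable {T : Fin n → E →L[ℂ] E}

/-- The hypothesis makes `⊕Δ` a left inverse of `T*T` on `Im T*`. Closed range makes `T*T`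
surjective there, so the inverse is two-sided and `⊕Δ` preserves `Im T*`. -/
theorem inverseIdentity_of_deltaOp_adjoint {m : ℕ} (hclosed : IsClosed ((rowOp T).range : Set E))
    (h : ∀ i x, deltaOp m T ((T i).adjoint (sigmaMap T (ContinuousLinearMap.id ℂ E) x)) =
      (T i).adjoint x) : InverseIdentity m T := by
  have key : ∀ x, ampliation n (deltaOp m T) ((rowOp T).adjoint (rowOp T ((rowOp T).adjoint x))) =
      (rowOp T).adjoint x := by
    intro x
    have e : rowOp T ((rowOp T).adjoint x) = sigmaMap T (ContinuousLinearMap.id ℂ E) x := by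
      simp [rowOp_apply, rowOp_adjoint_apply, sigmaMap_apply]
    rw [e]
    refine PiLp.ext fun i => ?_
    rw [ampliation_apply, rowOp_adjoint_apply, rowOp_adjoint_apply, h]
  rintro _ ⟨x, rfl⟩
  obtain ⟨x', hx'⟩ := exists_adjoint_apply_self_adjoint_eq _ hclosed x
  rw [ContinuousLinearMap.coe_coe]
  refine ⟨⟨x', ?_⟩, ?_, key x⟩
  · rw [← hx', key]
    rfl
  · rw [← hx', key]

theorem sigmaMap_adjoint (T : Fin n → E →L[ℂ] E) (X : E →L[ℂ] E) :
    (sigmaMap T X).adjoint = sigmaMap T X.adjoint := by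
  simp only [sigmaMap, map_sum, ContinuousLinearMap.adjoint_comp,
    ContinuousLinearMap.adjoint_adjoint, ContinuousLinearMap.comp_assoc]

theorem sigmaMap_iterate_id_adjoint (T : Fin n → E →L[ℂ] E) (j : ℕ) :
    ((sigmaMap T)^[j] (ContinuousLinearMap.id ℂ E)).adjoint =
      (sigmaMap T)^[j] (ContinuousLinearMap.id ℂ E) := by
  induction j with
  | zero => exact star_one (E →L[ℂ] E)
  | succ j ih => rw [Function.iterate_succ_apply', sigmaMap_adjoint, ih]

theorem deltaOp_adjoint (m : ℕ) (T : Fin n → E →L[ℂ] E) :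
    (deltaOp m T).adjoint = deltaOp m T := by
  rw [deltaOp, map_sum]
  refine Finset.sum_congr rfl fun j _ => ?_
  rw [map_smulₛₗ, sigmaMap_iterate_id_adjoint]
  simp

/-- This is the adjoint of the hypothesis, as `Δ` and `σ(1)` are selfadjoint. -/
theorem deltaOp_adjoint_sigmaMap {m : ℕ} (h : ∀ i x,
    sigmaMap T (ContinuousLinearMap.id ℂ E) (T i (deltaOp m T x)) = T i x) (i : Fin n) (x : E) :
    deltaOp m T ((T i).adjoint (sigmaMap T (ContinuousLinearMap.id ℂ E) x)) =
      (T i).adjoint x := by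
  refine ext_inner_right ℂ fun y => ?_
  rw [ContinuousLinearMap.adjoint_inner_left, ← h, ← deltaOp_adjoint,
    ContinuousLinearMap.adjoint_inner_left, ContinuousLinearMap.adjoint_inner_left,
    deltaOp_adjoint]
  have h1 : (sigmaMap T (ContinuousLinearMap.id ℂ E)).adjoint =
      sigmaMap T (ContinuousLinearMap.id ℂ E) := sigmaMap_iterate_id_adjoint T 1
  conv_lhs => rw [← h1]
  exact ContinuousLinearMap.adjoint_inner_left _ _ _

variable {K : Submodule ℂ E} {M : ℕ}

theorem IsReducing.sigmaMap_iterate_mem (h : IsReducing T K) (j : ℕ) :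
    ∀ x ∈ K, (sigmaMap T)^[j] (ContinuousLinearMap.id ℂ E) x ∈ K := by
  induction j with
  | zero => exact fun x hx => hx
  | succ j ih =>
    intro x hx
    rw [Function.iterate_succ_apply', sigmaMap_apply]
    exact Submodule.sum_mem _ fun i _ => h.1 i _ (ih _ (h.2 i x hx))

theorem IsReducing.deltaOp_mem (h : IsReducing T K) (m : ℕ) {x : E} (hx : x ∈ K) :
    deltaOp m T x ∈ K := by
  rw [deltaOp_apply]
  exact Submodule.sum_mem _ fun j _ => K.smul_mem _ (h.sigmaMap_iterate_mem j x hx)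

/-- All iterates `σʲ(1)` act as the identity on `K`, and the coefficients of `Δ` sum to `1 - (1 -
1)^(M+1) = 1`. -/
theorem IsReducing.deltaOp_eq_self (h : IsReducing T K)
    (hK : ∀ x ∈ K, ∑ i, T i ((T i).adjoint x) = x) {x : E} (hx : x ∈ K) :
    deltaOp (M + 1) T x = x := by
  have hj : ∀ j, ∀ x ∈ K, (sigmaMap T)^[j] (ContinuousLinearMap.id ℂ E) x = x := by
    intro j
    induction j with
    | zero => exact fun x hx => rfl
    | succ j ih =>
      intro x hx
      rw [Function.iterate_succ_apply', sigmaMap_apply]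
      exact (Finset.sum_congr rfl fun i _ => by rw [ih _ (h.2 i x hx)]).trans (hK x hx)
  have hs : ∑ j ∈ Finset.range (M + 1), (-1 : ℂ) ^ j * ((M + 1).choose (j + 1) : ℂ) = 1 := by
    have h0 := congrArg (Int.cast : ℤ → ℂ)
      (Int.alternating_sum_range_choose_of_ne (n := M + 1) M.succ_ne_zero)
    rw [Finset.sum_range_succ'] at h0
    push_cast [pow_succ] at h0
    simp only [mul_neg, neg_mul, Finset.sum_neg_distrib, mul_one,
      Nat.choose_zero_right, Nat.cast_one] at h0
    linear_combination -h0
  rw [deltaOp_apply, Finset.sum_congr rfl fun j _ => by rw [hj j x hx], ← Finset.sum_smul, hs,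
    one_smul]

/-- In positive degree `σ(1)` contributes the factor `cₖ/cₖ₊₁` and `Δ` the inverse factor; in degree
zero both sides vanish. -/
theorem pow_sigmaMap_tuple_deltaOp {D : Type*} [NormedAddCommGroup D] [InnerProductSpace ℂ D]
    {P : E →L[ℂ] D} {z : EuclideanSpace ℂ (Fin n)} (h : ∀ N, ShiftRelations M T P z N) (i : Fin n)
    (x : E) (k : ℕ) : P ((adjointPencil T z ^ k)
      (sigmaMap T (ContinuousLinearMap.id ℂ E) (T i (deltaOp (M + 1) T x)))) =
      P ((adjointPencil T z ^ k) (T i x)) := by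
  cases k with
  | zero => simp [sigmaMap_apply, (h 0).1]
  | succ k =>
    have hc : ((k + 1 + M).choose M : ℂ) ≠ 0 := by
      exact_mod_cast (Nat.choose_pos (Nat.le_add_left M (k + 1))).ne'
    have h1 := (h (k + 1)).2 k k.lt_succ_self i
    refine smul_right_injective _ hc (smul_right_injective _ hc ?_)
    simp only
    rw [(h (k + 1)).pow_sigmaMap k.lt_succ_self, ContinuousLinearMap.id_apply,
      ← mul_apply_eq_comp, ← pow_succ, smul_comm, h1, h1, mul_comm, mul_smul, (h k).pow_deltaOp]
    simp only [smul_smul]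
    congr 1
    ring

end Converse

/-! ### Point evaluations on the shift part and the converse implication -/

section ConverseDecomposition

variable {n : ℕ} {H D : Type*} [NormedAddCommGroup H] [InnerProductSpace ℂ H] [CompleteSpace H]
  [NormedAddCommGroup D] [InnerProductSpace ℂ D] [CompleteSpace D]
  {T : Fin n → H →L[ℂ] H} {K : Submodule ℂ H} {M : ℕ}

/-- The evaluation `x ↦ (U π x)(z)`, where `π` is the orthogonal projection onto `Kᗮ`. -/
noncomputable def compressedEval (U : Kᗮ ≃ₗᵢ[ℂ] BallSpace n (M + 1) D) (z : UnitBall n) :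
    H →L[ℂ] D :=
  (RKHS.kerFun (BallSpace n (M + 1) D) z).adjoint ∘L
    (U.toContinuousLinearEquiv : Kᗮ →L[ℂ] BallSpace n (M + 1) D) ∘L Kᗮ.orthogonalProjectionOnto

theorem compressedEval_apply (U : Kᗮ ≃ₗᵢ[ℂ] BallSpace n (M + 1) D) (z : UnitBall n) (x : H) :
    compressedEval U z x = U (Kᗮ.orthogonalProjectionOnto x) z := by
  simp [compressedEval]

theorem compressedEval_of_mem (U : Kᗮ ≃ₗᵢ[ℂ] BallSpace n (M + 1) D) (z : UnitBall n) {x : H}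
    (hx : x ∈ K) : compressedEval U z x = 0 := by
  rw [compressedEval_apply, Submodule.orthogonalProjectionOnto_eq_zero_iff.2
    (Submodule.le_orthogonal_orthogonal K hx)]
  simp

theorem mem_of_compressedEval_eq_zero [CompleteSpace K] (U : Kᗮ ≃ₗᵢ[ℂ] BallSpace n (M + 1) D)
    {x : H} (h : ∀ z, compressedEval U z x = 0) : x ∈ K := by
  have h1 : U (Kᗮ.orthogonalProjectionOnto x) = 0 := RKHS.ext fun z => by
    rw [← compressedEval_apply, h]
    simp
  rw [map_eq_zero_iff U U.injective, Submodule.orthogonalProjectionOnto_eq_zero_iff,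
    Submodule.orthogonal_orthogonal] at h1
  exact h1

theorem compressedEval_adjoint_apply (U : Kᗮ ≃ₗᵢ[ℂ] BallSpace n (M + 1) D) (w : UnitBall n)
    (d : D) : (compressedEval U w).adjoint d =
      (U.symm (RKHS.kerFun (BallSpace n (M + 1) D) w d) : Kᗮ) := by
  refine ext_inner_right ℂ fun x => ?_
  rw [ContinuousLinearMap.adjoint_inner_left, compressedEval_apply, ← RKHS.kerFun_inner,
    ← Submodule.inner_orthogonalProjectionOnto_eq_of_mem_left, ← U.inner_map_map,
    U.apply_symm_apply]

theorem compressedEval_adjoint (U : Kᗮ ≃ₗᵢ[ℂ] BallSpace n (M + 1) D) (z w : UnitBall n) (d : D) :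
    compressedEval U z ((compressedEval U w).adjoint d) = opKernel n (M + 1) D z w d := by
  rw [compressedEval_adjoint_apply, compressedEval_apply,
    Submodule.orthogonalProjectionOnto_mem_subspace_eq_self, U.apply_symm_apply, RKHS.kerFun_apply,
    RKHS.OfKernel.kernel_ofKernel]

theorem IsReducing.compressedEval_tuple (hr : IsReducing T K) {T₁ : Fin n → Kᗮ →L[ℂ] Kᗮ}
    (h₁ : ∀ (i : Fin n) (x : Kᗮ), T i x = T₁ i x) {U : Kᗮ ≃ₗᵢ[ℂ] BallSpace n (M + 1) D}
    (hU : ∀ (i : Fin n) (x : Kᗮ) (z : UnitBall n),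
      U (T₁ i x) z = (z : EuclideanSpace ℂ (Fin n)) i • U x z) (z : UnitBall n) (i : Fin n)
    (x : H) : compressedEval U z (T i x) =
      (z : EuclideanSpace ℂ (Fin n)) i • compressedEval U z x := by
  rw [compressedEval_apply, compressedEval_apply, ← hU]
  congr 2
  refine Subtype.ext ?_
  rw [← h₁]
  exact (apply_starProjection_of_invariant (hr.orthogonal.1 i) (hr.orthogonal.orthogonal.1 i)
    x).symm

theorem IsReducing.adjointPencil_pow_mem (hr : IsReducing T K) (z : EuclideanSpace ℂ (Fin n))
    (k : ℕ) {x : H} (hx : x ∈ K) : (adjointPencil T z ^ k) x ∈ K := by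
  induction k with
  | zero => exact hx
  | succ k ih =>
    rw [pow_succ', mul_apply_eq_comp, adjointPencil_apply]
    exact Submodule.sum_mem _ fun i _ => K.smul_mem _ (hr.2 i _ ih)

/-- The origin of the unit ball. -/
def UnitBall.origin (n : ℕ) : UnitBall n := ⟨0, mem_ball_zero_iff.2 (by simp)⟩

/-- Compare adjoints on a vector `d`: both images have the same kernel function under every
evaluation, so their difference lies in `K`. Both operators vanish on `K`, so the difference also
lies in `Kᗮ`. -/
theorem evalOp_compressedEval [CompleteSpace K] (hT : IsRowContraction T) (hr : IsReducing T K)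
    {U : Kᗮ ≃ₗᵢ[ℂ] BallSpace n (M + 1) D}
    (hU : ∀ (z : UnitBall n) i x, compressedEval U z (T i x) =
      (z : EuclideanSpace ℂ (Fin n)) i • compressedEval U z x) (w : UnitBall n) :
    evalOp (M + 1) T (compressedEval U (UnitBall.origin n)) w = compressedEval U w := by
  set P := compressedEval U (UnitBall.origin n) with hP
  refine ContinuousLinearMap.adjoint.injective (ContinuousLinearMap.ext fun d => ?_)
  have hort : ∀ e : H →L[ℂ] D, (∀ x ∈ K, e x = 0) → e.adjoint d ∈ Kᗮ := fun e he x hx => by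
    rw [ContinuousLinearMap.adjoint_inner_right, he x hx, inner_zero_left]
  have hmem : (evalOp (M + 1) T P w).adjoint d - (compressedEval U w).adjoint d ∈ K := by
    refine mem_of_compressedEval_eq_zero U fun z => ?_
    have heP : ∀ d, compressedEval U z (P.adjoint d) = d := fun d => by
      rw [hP, compressedEval_adjoint, opKernel_apply]
      simp [UnitBall.origin]
    rw [map_sub, compressedEval_adjoint, opKernel_apply, apply_adjoint_evalOp (hU z) heP
      (hT.norm_adjointPencil_lt_one w) (norm_inner_unitBall_lt_one w z), sub_self]
  have hmem' : (evalOp (M + 1) T P w).adjoint d - (compressedEval U w).adjoint d ∈ Kᗮ :=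
    Kᗮ.sub_mem (hort _ fun x hx => evalOp_eq_zero_of_pow_eq_zero
        (hT.norm_adjointPencil_lt_one w) fun k =>
          compressedEval_of_mem U _ (hr.adjointPencil_pow_mem _ k hx))
      (hort _ fun x hx => compressedEval_of_mem U w hx)
  exact sub_eq_zero.1 (inner_self_eq_zero.1 (hmem' _ hmem))

/-- The Wold decomposition yields the operator identity. -/
theorem inverseIdentity_of_wold [CompleteSpace K] (hT : IsRowContraction T)
    (hclosed : IsClosed ((rowOp T).range : Set H)) {T₀ : Fin n → K →L[ℂ] K}
    {T₁ : Fin n → Kᗮ →L[ℂ] Kᗮ} (h₀ : ∀ (i : Fin n) (x : K), T i x = T₀ i x)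
    (h₁ : ∀ (i : Fin n) (x : Kᗮ), T i x = T₁ i x) (hco : IsSphericalCoisometry T₀)
    (hsh : IsUnitarilyEquivalentToShift (M + 1) D T₁) : InverseIdentity (M + 1) T := by
  have hK₁ : ∀ i, ∀ x ∈ Kᗮ, T i x ∈ Kᗮ := fun i x hx => by
    rw [h₁ i ⟨x, hx⟩]
    exact Subtype.coe_prop _
  have hadj := fun i (x : K) => adjoint_restrict_apply (h₀ i) (hK₁ i) x
  have hr : IsReducing T K := by
    refine ⟨fun i x hx => ?_, fun i x hx => ?_⟩
    · rw [h₀ i ⟨x, hx⟩]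
      exact Subtype.coe_prop _
    · rw [← hadj i ⟨x, hx⟩]
      exact Subtype.coe_prop _
  have hsum : ∀ x ∈ K, ∑ i, T i ((T i).adjoint x) = x := by
    intro x hx
    have h2 := congrArg (fun A : K →L[ℂ] K => (A ⟨x, hx⟩ : H)) hco.2.2
    simp only [ContinuousLinearMap.adjoint_adjoint, sum_apply, Submodule.coe_sum,
      ContinuousLinearMap.comp_apply, ← h₀, hadj, ContinuousLinearMap.id_apply] at h2
    exact h2
  obtain ⟨U, hU⟩ := hsh
  have hev := hr.compressedEval_tuple h₁ hU
  have heval := evalOp_compressedEval hT hr hev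
  have hrel : ∀ z N, ShiftRelations M T (compressedEval U (UnitBall.origin n)) z N :=
    shiftRelations_of_evalOp hT fun z hz i x => by
      have := heval ⟨z, mem_ball_zero_iff.2 hz⟩
      rw [this]
      exact hev _ i x
  refine inverseIdentity_of_deltaOp_adjoint hclosed (deltaOp_adjoint_sigmaMap fun i x => ?_)
  obtain ⟨u, hu, v, hv, rfl⟩ := K.exists_add_mem_mem_orthogonal x
  simp only [map_add]
  congr 1
  · have hTu := hr.1 i u hu
    rw [hr.deltaOp_eq_self hsum hu, sigmaMap_apply]
    exact hsum _ hTu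
  -- The difference has zero evaluations, hence lies in `K`; it lies in `Kᗮ` because `v` does and
  -- `Kᗮ` is reducing.
  · have hmem : sigmaMap T (ContinuousLinearMap.id ℂ H) (T i (deltaOp (M + 1) T v)) - T i v ∈ K := by
      refine mem_of_compressedEval_eq_zero U fun z => ?_
      rw [← heval]
      refine evalOp_eq_zero_of_pow_eq_zero (hT.norm_adjointPencil_lt_one z) fun k => ?_
      rw [map_sub, map_sub, pow_sigmaMap_tuple_deltaOp (hrel _), sub_self]
    have hro := hr.orthogonal
    have hmem' : sigmaMap T (ContinuousLinearMap.id ℂ H) (T i (deltaOp (M + 1) T v)) - T i v ∈ Kᗮ :=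
      Kᗮ.sub_mem (hro.sigmaMap_iterate_mem 1 _ (hro.1 i _ (hro.deltaOp_mem _ hv))) (hro.1 i _ hv)
    exact sub_eq_zero.1 (inner_self_eq_zero.1 (hmem' _ hmem))

end ConverseDecomposition

theorem IsRegularAtZero.isClosed_range {n : ℕ} {E : Type*} [NormedAddCommGroup E]
    [InnerProductSpace ℂ E] {T : Fin n → E →L[ℂ] E} (h : IsRegularAtZero T) :
    IsClosed ((rowOp T).range : Set E) := by
  obtain ⟨ε, hε, h⟩ := h
  have h0 := (h 0 (by simpa using hε)).1
  have hz : scalarRow E (0 : EuclideanSpace ℂ (Fin n)) = 0 :=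
    ContinuousLinearMap.ext fun y => by simp [scalarRow_apply]
  rwa [hz, sub_zero] at h0

theorem mainTheorem1 {H : Type u} [NormedAddCommGroup H] [InnerProductSpace ℂ H] [CompleteSpace H]
    (n m : ℕ) (hm : 1 ≤ m) (T : Fin n → H →L[ℂ] H)
    (hcomm : IsCommutingTuple T) (hrow : IsRowContraction T) (hreg : IsRegularAtZero T) :
    InverseIdentity m T ↔
      ∃ (H₀ : Submodule ℂ H) (_ : CompleteSpace H₀)
        (T₀ : Fin n → H₀ →L[ℂ] H₀) (T₁ : Fin n → H₀ᗮ →L[ℂ] H₀ᗮ),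
        (∀ (i : Fin n) (x : H₀), T i x = T₀ i x) ∧
        (∀ (i : Fin n) (x : H₀ᗮ), T i x = T₁ i x) ∧
        IsSphericalCoisometry T₀ ∧
        ∃ (D : Type u) (_ : NormedAddCommGroup D) (_ : InnerProductSpace ℂ D)
          (_ : CompleteSpace D), IsUnitarilyEquivalentToShift m D T₁ := by
  obtain ⟨M, rfl⟩ := Nat.exists_eq_add_of_le' hm
  refine ⟨fun h => h.exists_wold hcomm hrow hreg, ?_⟩
  rintro ⟨H₀, _, T₀, T₁, h₀, h₁, hco, D, _, _, _, hsh⟩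
  exact inverseIdentity_of_wold hrow hreg.isClosed_range h₀ h₁ hco hsh
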